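/- Let $H$ be a complex Hilbert space. For a bounded operator $T$ on $H$ and $t\ge 0$ let $\mu(t,T)=\inf\{\|T-R\| : R \text{ bounded},\ \operatorname{rank}R\le t\}$. For $p>0$ let $\mathcal L_{p,\infty}$ be the set of compact operators $T$ on $H$ with $\|T\|_{p,\infty}:=\sup_{t\ge 0}t^{1/p}\mu(t,T)<\infty$, and let $(\mathcal L_{p,\infty})_0$ be the closure of the finite rank operators in $\mathcal L_{p,\infty}$ with respect to the quasi-norm $\|\cdot\|_{p,\infty}$. For a self-adjoint operator $T$ put $T_\pm=\tfrac12(|T|\pm T)$. A possibly unbounded operator, taken with its natural domain, is said to belong to one of these classes if it is densely defined and has a bounded extension to $H$ that belongs to the class. **Theorem.** Let $p>0$, let $B\ge 0$ be a bounded operator on $H$, and let $A$ be a (possibly unbounded) self-adjoint operator on $H$. Assume that, for both choices of the sign $\pm$, 1. $AB^{1/2}\in\mathcal L_{2p,\infty}$, 2. $[B^{1/2},A_\pm]B\in(\mathcal L_{2p/3,\infty})_0$, 3. $[B^{3/2},A_\pm]\in(\mathcal L_{2p/3,\infty})_0$. Then, for both choices of the sign, $$(B^{1/2}AB^{1/2})_\pm-B^{1/2}A_\pm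 B^{1/2}\in(\mathcal L_{p,\infty})_0 .$$ -/

import Mathlib

/-! ### Singular value function and weak Schatten ideals -/

/-- The singular value function `μ(t, T) = inf { ‖T - R‖ : rank R ≤ t }` of a bounded operator. -/
noncomputable def singularValueFun {H : Type*} [NormedAddCommGroup H] [InnerProductSpace ℂ H]
    (T : H →L[ℂ] H) (t : ℝ) : ℝ :=
  sInf {r : ℝ | ∃ R : H →L[ℂ] H, Module.Finite ℂ (LinearMap.range R.toLinearMap) ∧
    (Module.finrank ℂ (LinearMap.range R.toLinearMap) : ℝ) ≤ t ∧ r = ‖T - R‖}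

/-- The weak Schatten quasi-norm `‖T‖_{p,∞} = sup_{t ≥ 0} t^{1/p} μ(t, T)`, with values in
`[0, ∞]`. -/
noncomputable def weakSchattenNorm {H : Type*} [NormedAddCommGroup H] [InnerProductSpace ℂ H]
    (p : ℝ) (T : H →L[ℂ] H) : ENNReal :=
  ⨆ t : NNReal, ENNReal.ofReal ((t : ℝ) ^ (1 / p) * singularValueFun T t)

/-- The weak Schatten ideal `𝓛_{p,∞}`: compact operators with finite weak Schatten quasi-norm. -/
def weakSchatten (H : Type*) [NormedAddCommGroup H] [InnerProductSpace ℂ H] (p : ℝ) :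
    Set (H →L[ℂ] H) :=
  {T | IsCompactOperator T ∧ weakSchattenNorm p T < ⊤}

/-- The ideal `(𝓛_{p,∞})₀`: the closure of the finite rank operators in `𝓛_{p,∞}` with respect to
the quasi-norm of `𝓛_{p,∞}`. -/
def weakSchattenZero (H : Type*) [NormedAddCommGroup H] [InnerProductSpace ℂ H] (p : ℝ) :
    Set (H →L[ℂ] H) :=
  {T | T ∈ weakSchatten H p ∧ ∀ ε : ℝ, 0 < ε → ∃ F : H →L[ℂ] H,
    Module.Finite ℂ (LinearMap.range F.toLinearMap) ∧
      weakSchattenNorm p (T - F) < ENNReal.ofReal ε}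

/-! ### Partially defined operators -/

/-- A bounded operator regarded as an everywhere defined operator. -/
def ContinuousLinearMap.toPartial {H : Type*} [NormedAddCommGroup H] [InnerProductSpace ℂ H]
    (S : H →L[ℂ] H) : H →ₗ.[ℂ] H :=
  S.toLinearMap.toPMap ⊤

/-- The product `T S` of a partially defined operator `T` and a bounded operator `S`, with its
natural domain `{x | S x ∈ dom T}`. -/
def LinearPMap.mulBounded {H : Type*} [NormedAddCommGroup H] [InnerProductSpace ℂ H]
    (T : H →ₗ.[ℂ] H) (S : H →L[ℂ] H) : H →ₗ.[ℂ] H where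
  domain := T.domain.comap S.toLinearMap
  toFun := T.toFun ∘ₗ (S.toLinearMap.restrict (p := T.domain.comap S.toLinearMap)
    (q := T.domain) (fun _ hx => hx))

/-- The product `S T` of a bounded operator `S` and a partially defined operator `T`, with its
natural domain `dom T`. -/
def LinearPMap.boundedMul {H : Type*} [NormedAddCommGroup H] [InnerProductSpace ℂ H]
    (S : H →L[ℂ] H) (T : H →ₗ.[ℂ] H) : H →ₗ.[ℂ] H :=
  S.toLinearMap.compPMap T

/-- The commutator `[S, T] = S T - T S` of a bounded operator `S` and a partially defined operator
`T`, with its natural domain `{x ∈ dom T | S x ∈ dom T}`. -/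
def LinearPMap.commutator {H : Type*} [NormedAddCommGroup H] [InnerProductSpace ℂ H]
    (S : H →L[ℂ] H) (T : H →ₗ.[ℂ] H) : H →ₗ.[ℂ] H :=
  LinearPMap.boundedMul S T - T.mulBounded S

/-- A partially defined operator belongs to a class `𝓘` of bounded operators if it is densely
defined and its (necessarily unique) bounded extension exists and lies in `𝓘`. -/
def LinearPMap.MemIdeal {H : Type*} [NormedAddCommGroup H] [InnerProductSpace ℂ H]
    (T : H →ₗ.[ℂ] H) (𝓘 : Set (H →L[ℂ] H)) : Prop :=
  Dense (T.domain : Set H) ∧ ∃ S ∈ 𝓘, T ≤ S.toPartial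

/-! ### Absolute value, positive and negative parts -/

/-- The closure of the graph of `T`, as a subspace of the Hilbert space `H ⊕ H`. -/
def LinearPMap.closedGraph {H : Type*} [NormedAddCommGroup H] [InnerProductSpace ℂ H]
    (T : H →ₗ.[ℂ] H) : Submodule ℂ (WithLp 2 (H × H)) :=
  (T.graph.comap (WithLp.linearEquiv 2 ℂ (H × H)).toLinearMap).topologicalClosure

instance LinearPMap.closedGraph_hasOrthogonalProjection {H : Type*} [NormedAddCommGroup H]
    [InnerProductSpace ℂ H] [CompleteSpace H] (T : H →ₗ.[ℂ] H) :
    T.closedGraph.HasOrthogonalProjection :=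
  haveI : CompleteSpace T.closedGraph :=
    (Submodule.isClosed_topologicalClosure _).completeSpace_coe
  Submodule.HasOrthogonalProjection.ofCompleteSpace _

/-- The map `x ↦ P (x, 0)`, with `P` the orthogonal projection of `H ⊕ H` onto the closed graph
of `T`. -/
noncomputable def LinearPMap.graphProj {H : Type*} [NormedAddCommGroup H] [InnerProductSpace ℂ H]
    [CompleteSpace H] (T : H →ₗ.[ℂ] H) : H →L[ℂ] WithLp 2 (H × H) :=
  T.closedGraph.starProjection ∘L
    (WithLp.prodContinuousLinearEquiv 2 ℂ H H).symm.toContinuousLinearMap ∘L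
    ContinuousLinearMap.inl ℂ H H

/-- The bounded operator `(1 + T*T)⁻¹` for a closed densely defined operator `T`. It is the first
component of the projection of `(x, 0)` onto the graph: `(x, 0) - (u, T u)` is orthogonal
to the graph of `T` if and only if `T u ∈ dom T*` and `u + T*T u = x`. -/
noncomputable def LinearPMap.graphResolvent {H : Type*} [NormedAddCommGroup H]
    [InnerProductSpace ℂ H] [CompleteSpace H] (T : H →ₗ.[ℂ] H) : H →L[ℂ] H :=
  WithLp.fstL 2 ℂ H H ∘L T.graphProj

/-- The bounded operator `T (1 + T*T)⁻¹` for a closed densely defined operator `T`. -/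
noncomputable def LinearPMap.mulGraphResolvent {H : Type*} [NormedAddCommGroup H]
    [InnerProductSpace ℂ H] [CompleteSpace H] (T : H →ₗ.[ℂ] H) : H →L[ℂ] H :=
  WithLp.sndL 2 ℂ H H ∘L T.graphProj

/-- The graph of the absolute value of a closed densely defined operator `T`. Since
`|T| (1 + T*T)⁻¹` is the absolute value of the bounded operator `T (1 + T*T)⁻¹` and the range
`dom (T*T)` of `(1 + T*T)⁻¹` is a core of `|T|`, it is the closure of the
set of pairs `((1 + T*T)⁻¹ x, |T (1 + T*T)⁻¹| x)`. -/
noncomputable def LinearPMap.absGraph {H : Type*} [NormedAddCommGroup H] [InnerProductSpace ℂ H]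
    [CompleteSpace H] (T : H →ₗ.[ℂ] H) : Submodule ℂ (H × H) :=
  (LinearMap.range
    (T.graphResolvent.prod (CFC.abs T.mulGraphResolvent)).toLinearMap).topologicalClosure

/-- The absolute value `|T| = (T*T)^{1/2}` of a closed densely defined operator `T`. -/
noncomputable def LinearPMap.absOp {H : Type*} [NormedAddCommGroup H] [InnerProductSpace ℂ H]
    [CompleteSpace H] (T : H →ₗ.[ℂ] H) : H →ₗ.[ℂ] H :=
  T.absGraph.toLinearPMap

/-- The positive part `T₊ = ½(|T| + T)` of a self-adjoint operator `T`. -/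
noncomputable def LinearPMap.posPartOp {H : Type*} [NormedAddCommGroup H] [InnerProductSpace ℂ H]
    [CompleteSpace H] (T : H →ₗ.[ℂ] H) : H →ₗ.[ℂ] H :=
  (1 / 2 : ℂ) • (T.absOp + T)

/-- The negative part `T₋ = ½(|T| - T)` of a self-adjoint operator `T`. -/
noncomputable def LinearPMap.negPartOp {H : Type*} [NormedAddCommGroup H] [InnerProductSpace ℂ H]
    [CompleteSpace H] (T : H →ₗ.[ℂ] H) : H →ₗ.[ℂ] H :=
  (1 / 2 : ℂ) • (T.absOp - T)

/-! ### The absolute value is well defined -/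

theorem ContinuousLinearMap.norm_cfcAbs_apply {H : Type*} [NormedAddCommGroup H]
    [InnerProductSpace ℂ H] [CompleteSpace H] (S : H →L[ℂ] H) (x : H) :
    ‖CFC.abs S x‖ = ‖S x‖ := by
  have h1 : (CFC.abs S).adjoint = CFC.abs S := (CFC.abs_nonneg S).isSelfAdjoint
  have h2 : CFC.abs S * CFC.abs S = S.adjoint * S := CFC.abs_mul_abs S
  have h3 : inner ℂ (CFC.abs S x) (CFC.abs S x) = inner ℂ (S x) (S x) := by
    rw [← ContinuousLinearMap.adjoint_inner_left, ← ContinuousLinearMap.adjoint_inner_left, h1]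
    exact congrArg (fun V : H →L[ℂ] H => inner ℂ (V x) x) h2
  rw [inner_self_eq_norm_sq_to_K, inner_self_eq_norm_sq_to_K] at h3
  have h4 : ‖CFC.abs S x‖ ^ 2 = ‖S x‖ ^ 2 := by exact_mod_cast h3
  exact (pow_left_inj₀ (norm_nonneg _) (norm_nonneg _) two_ne_zero).1 h4

theorem LinearPMap.mem_closedGraph_iff {H : Type*} [NormedAddCommGroup H] [InnerProductSpace ℂ H]
    {T : H →ₗ.[ℂ] H} (hT : T.IsClosed) (u : WithLp 2 (H × H)) :
    u ∈ T.closedGraph ↔ (u.fst, u.snd) ∈ T.graph := by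
  have hc : _root_.IsClosed ((T.graph.comap (WithLp.linearEquiv 2 ℂ (H × H)).toLinearMap :
      Submodule ℂ (WithLp 2 (H × H))) : Set (WithLp 2 (H × H))) :=
    _root_.IsClosed.preimage (WithLp.prod_continuous_ofLp 2 H H) hT
  rw [LinearPMap.closedGraph, hc.submodule_topologicalClosure_eq]
  rfl

theorem LinearPMap.inner_graphProj {H : Type*} [NormedAddCommGroup H] [InnerProductSpace ℂ H]
    [CompleteSpace H] (T : H →ₗ.[ℂ] H) (x : H) {u : WithLp 2 (H × H)} (hu : u ∈ T.closedGraph) :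
    inner ℂ (T.graphProj x) u = inner ℂ x u.fst := by
  change inner ℂ (T.closedGraph.starProjection (WithLp.toLp 2 (x, 0))) u = _
  rw [Submodule.inner_starProjection_left_eq_right,
    Submodule.starProjection_eq_self_iff.2 hu, WithLp.prod_inner_apply]
  simp

theorem LinearPMap.closedGraph_eq_closure_range {H : Type*} [NormedAddCommGroup H]
    [InnerProductSpace ℂ H] [CompleteSpace H] {T : H →ₗ.[ℂ] H} (hT : T.IsClosed) :
    (LinearMap.range T.graphProj.toLinearMap).topologicalClosure = T.closedGraph := by
  have hle : LinearMap.range T.graphProj.toLinearMap ≤ T.closedGraph := by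
    rintro _ ⟨x, rfl⟩
    exact Submodule.starProjection_apply_mem _ _
  have hle' : (LinearMap.range T.graphProj.toLinearMap).topologicalClosure ≤ T.closedGraph :=
    Submodule.topologicalClosure_minimal _ hle (Submodule.isClosed_topologicalClosure _)
  have : CompleteSpace (LinearMap.range T.graphProj.toLinearMap).topologicalClosure :=
    (Submodule.isClosed_topologicalClosure _).completeSpace_coe
  refine le_antisymm hle' fun u hu => ?_
  set K := (LinearMap.range T.graphProj.toLinearMap).topologicalClosure with hK
  have hw : u - K.starProjection u ∈ T.closedGraph :=
    Submodule.sub_mem _ hu (hle' (Submodule.starProjection_apply_mem _ _))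
  have hw' : u - K.starProjection u ∈ Kᗮ := Submodule.sub_starProjection_mem_orthogonal u
  have h1 : (u - K.starProjection u).fst = 0 := by
    rw [← inner_self_eq_zero (𝕜 := ℂ), ← LinearPMap.inner_graphProj T _ hw]
    exact hw' _ (Submodule.le_topologicalClosure _ ⟨_, rfl⟩)
  have h2 : (u - K.starProjection u).snd = 0 := by
    have := (LinearPMap.mem_closedGraph_iff hT _).1 hw
    exact LinearPMap.graph_fst_eq_zero_snd T this h1
  have h3 : u - K.starProjection u = 0 := by
    apply WithLp.ofLp_injective
    exact Prod.ext h1 h2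
  rw [sub_eq_zero.1 h3]
  exact Submodule.starProjection_apply_mem _ _

/-- If `S` and `S'` have equal norms pointwise, then any limit point of the pairs `(R x, S x)` has
a counterpart among the limit points of the pairs `(R x, S' x)`. -/
theorem LinearPMap.closure_range_prod_transfer {H : Type*} [NormedAddCommGroup H]
    [InnerProductSpace ℂ H] [CompleteSpace H] {R S S' : H →L[ℂ] H} (h : ∀ x, ‖S x‖ = ‖S' x‖)
    {u v : H} (huv : (u, v) ∈ _root_.closure (Set.range fun x => (R x, S x))) :
    ∃ w, (u, w) ∈ _root_.closure (Set.range fun x => (R x, S' x)) ∧ ‖w‖ = ‖v‖ := by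
  obtain ⟨f, hf, hlim⟩ := mem_closure_iff_seq_limit.1 huv
  choose x hx using hf
  have hf' : f = fun n => (R (x n), S (x n)) := funext fun n => (hx n).symm
  rw [hf'] at hlim
  have hR : Filter.Tendsto (fun n => R (x n)) Filter.atTop (nhds u) :=
    (continuous_fst.tendsto _).comp hlim
  have hS : Filter.Tendsto (fun n => S (x n)) Filter.atTop (nhds v) :=
    (continuous_snd.tendsto _).comp hlim
  have hC : CauchySeq fun n => S' (x n) := by
    have := hS.cauchySeq
    rw [Metric.cauchySeq_iff] at this ⊢
    intro ε hε
    obtain ⟨N, hN⟩ := this ε hε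
    refine ⟨N, fun m hm n hn => ?_⟩
    have := hN m hm n hn
    rwa [dist_eq_norm, ← ContinuousLinearMap.map_sub, h, ContinuousLinearMap.map_sub,
      ← dist_eq_norm] at this
  obtain ⟨w, hw⟩ := cauchySeq_tendsto_of_complete hC
  refine ⟨w, mem_closure_of_tendsto (hR.prodMk_nhds hw)
    (Filter.Eventually.of_forall fun n => ⟨x n, rfl⟩), ?_⟩
  refine tendsto_nhds_unique hw.norm ?_
  simpa [h] using hS.norm

theorem LinearPMap.mem_graph_iff_mem_closure {H : Type*} [NormedAddCommGroup H]
    [InnerProductSpace ℂ H] [CompleteSpace H] {T : H →ₗ.[ℂ] H} (hT : T.IsClosed) (u v : H) :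
    (u, v) ∈ T.graph ↔
      (u, v) ∈ _root_.closure (Set.range fun x => (T.graphResolvent x, T.mulGraphResolvent x)) := by
  have h1 := LinearPMap.mem_closedGraph_iff hT (WithLp.toLp 2 (u, v))
  rw [← LinearPMap.closedGraph_eq_closure_range hT] at h1
  refine h1.symm.trans ?_
  have h2 := (WithLp.prodContinuousLinearEquiv 2 ℂ H H).toHomeomorph.image_closure
    (Set.range T.graphProj)
  have h3 : (fun x => (T.graphResolvent x, T.mulGraphResolvent x)) =
      (WithLp.prodContinuousLinearEquiv 2 ℂ H H) ∘ T.graphProj := rfl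
  rw [h3, Set.range_comp]
  refine Iff.trans ?_ (Set.ext_iff.1 h2 (u, v))
  constructor
  · intro h
    exact ⟨_, h, rfl⟩
  · rintro ⟨y, hy, hyu⟩
    have : y = WithLp.toLp 2 (u, v) := by
      apply WithLp.ofLp_injective
      exact hyu
    rw [← this]
    exact hy

theorem LinearPMap.mem_absGraph_iff {H : Type*} [NormedAddCommGroup H] [InnerProductSpace ℂ H]
    [CompleteSpace H] (T : H →ₗ.[ℂ] H) (u v : H) :
    (u, v) ∈ T.absGraph ↔
      (u, v) ∈ _root_.closure (Set.range fun x => (T.graphResolvent x, CFC.abs T.mulGraphResolvent x)) :=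
  Iff.rfl

/-- For closed `T`, the subspace `absGraph T` is indeed the graph of `absOp T`. -/
theorem LinearPMap.graph_absOp {H : Type*} [NormedAddCommGroup H] [InnerProductSpace ℂ H]
    [CompleteSpace H] {T : H →ₗ.[ℂ] H} (hT : T.IsClosed) : T.absOp.graph = T.absGraph := by
  refine Submodule.toLinearPMap_graph_eq _ fun x hx hx0 => ?_
  obtain ⟨v, hv, hvn⟩ := LinearPMap.closure_range_prod_transfer
    (ContinuousLinearMap.norm_cfcAbs_apply T.mulGraphResolvent)
    ((LinearPMap.mem_absGraph_iff T x.1 x.2).1 hx)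
  rw [← LinearPMap.mem_graph_iff_mem_closure hT] at hv
  rw [LinearPMap.graph_fst_eq_zero_snd T hv hx0, norm_zero] at hvn
  exact norm_eq_zero.1 hvn.symm

/-- For closed `T`, the operators `|T|` and `T` have the same domain. -/
theorem LinearPMap.absOp_domain {H : Type*} [NormedAddCommGroup H] [InnerProductSpace ℂ H]
    [CompleteSpace H] {T : H →ₗ.[ℂ] H} (hT : T.IsClosed) : T.absOp.domain = T.domain := by
  ext u
  rw [LinearPMap.mem_domain_iff, LinearPMap.mem_domain_iff, LinearPMap.graph_absOp hT]
  constructor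
  · rintro ⟨v, hv⟩
    obtain ⟨w, hw, -⟩ := LinearPMap.closure_range_prod_transfer
      (ContinuousLinearMap.norm_cfcAbs_apply T.mulGraphResolvent)
      ((LinearPMap.mem_absGraph_iff T u v).1 hv)
    exact ⟨w, (LinearPMap.mem_graph_iff_mem_closure hT u w).2 hw⟩
  · rintro ⟨v, hv⟩
    obtain ⟨w, hw, -⟩ := LinearPMap.closure_range_prod_transfer
      (fun x => (ContinuousLinearMap.norm_cfcAbs_apply T.mulGraphResolvent x).symm)
      ((LinearPMap.mem_graph_iff_mem_closure hT u v).1 hv)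
    exact ⟨w, hw⟩

/-- For a bounded self-adjoint operator, `absOp` is the usual absolute value of the C*-algebra of
bounded operators. -/
theorem LinearPMap.absOp_toPartial {H : Type*} [NormedAddCommGroup H]
    [InnerProductSpace ℂ H] [CompleteSpace H] (C : H →L[ℂ] H) (hC : IsSelfAdjoint C) :
    C.toPartial.absOp = (CFC.abs C).toPartial := by
  have hdom : C.toPartial.domain = ⊤ := rfl
  have hcl : C.toPartial.IsClosed := by
    have : (C.toPartial.graph : Set (H × H)) = {p | p.2 = C p.1} := by
      ext ⟨a, b⟩
      simp [LinearPMap.mem_graph_iff, ContinuousLinearMap.toPartial, eq_comm]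
    change _root_.IsClosed _
    rw [this]
    exact isClosed_eq continuous_snd (C.continuous.comp continuous_fst)
  set T := C.toPartial with hT
  set R := T.graphResolvent
  set S := T.mulGraphResolvent
  have hSR : S = C * R := by
    ext x
    have : T.graphProj x ∈ T.closedGraph := Submodule.starProjection_apply_mem _ _
    rw [LinearPMap.mem_closedGraph_iff hcl, LinearPMap.mem_graph_iff] at this
    obtain ⟨y, hy1, hy2⟩ := this
    change (T.graphProj x).snd = C (T.graphProj x).fst
    exact hy2.symm.trans (congrArg C hy1)
  have hinn : ∀ x y, inner ℂ (R x) y + inner ℂ (S x) (C y) = inner ℂ x y := by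
    intro x y
    have hm : WithLp.toLp 2 (y, C y) ∈ T.closedGraph := by
      rw [LinearPMap.mem_closedGraph_iff hcl, LinearPMap.mem_graph_iff]
      exact ⟨⟨y, trivial⟩, rfl, rfl⟩
    have := LinearPMap.inner_graphProj T x hm
    rw [WithLp.prod_inner_apply] at this
    exact this
  have hR1 : (1 + C * C) * R = 1 := by
    ext x
    apply ext_inner_right ℂ
    intro y
    have := hinn x y
    rw [hSR] at this
    have h2 : inner ℂ ((C * R) x) (C y) = inner ℂ ((C * (C * R)) x) y := by
      have h3 := ContinuousLinearMap.adjoint_inner_left C y ((C * R) x)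
      rw [hC.adjoint_eq] at h3
      exact h3.symm
    rw [h2, ← inner_add_left] at this
    rw [add_mul, one_mul, mul_assoc]; exact this
  have hRpos : 0 ≤ R := by
    rw [ContinuousLinearMap.nonneg_iff_isPositive, ContinuousLinearMap.isPositive_iff_complex]
    intro x
    have hm : T.graphProj x ∈ T.closedGraph := Submodule.starProjection_apply_mem _ _
    have h := LinearPMap.inner_graphProj T x hm
    have h' := congrArg (starRingEnd ℂ) h
    rw [inner_conj_symm, inner_conj_symm] at h'
    change inner ℂ _ _ = inner ℂ (R x) x at h'
    rw [← h', inner_self_eq_norm_sq_to_K]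
    norm_cast
    simp
  have hRsa : IsSelfAdjoint R := IsSelfAdjoint.of_nonneg hRpos
  have hCC : IsSelfAdjoint (1 + C * C) := by
    apply IsSelfAdjoint.add (.one _)
    simpa [hC.star_eq] using IsSelfAdjoint.star_mul_self C
  have hR2 : R * (1 + C * C) = 1 := by
    have := congrArg star hR1
    rwa [star_mul, hRsa.star_eq, hCC.star_eq, star_one] at this
  have hcomm : Commute C R := by
    have h1 : C * (1 + C * C) = (1 + C * C) * C := by noncomm_ring
    change C * R = R * C
    calc C * R = (R * (1 + C * C)) * (C * R) := by rw [hR2, one_mul]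
      _ = R * ((1 + C * C) * C) * R := by noncomm_ring
      _ = R * C * ((1 + C * C) * R) := by rw [← h1]; noncomm_ring
      _ = R * C := by rw [hR1, mul_one]
  have habs : CFC.abs S = CFC.abs C * R := by
    rw [hSR, hcomm.cfcAbs_mul_eq (by rw [hRsa.star_eq]; exact hcomm), CFC.abs_of_nonneg R hRpos]
  have hd : T.absOp.domain = ⊤ := by rw [LinearPMap.absOp_domain hcl]; rfl
  refine LinearPMap.ext (hd.trans rfl) fun {x} hx hy => ?_
  have hmem : (x, CFC.abs C x) ∈ T.absGraph := by
    apply Submodule.le_topologicalClosure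
    refine ⟨(1 + C * C) x, ?_⟩
    change (R ((1 + C * C) x), CFC.abs S ((1 + C * C) x)) = _
    have e1 : R ((1 + C * C) x) = x := congrArg (fun V : H →L[ℂ] H => V x) hR2
    rw [habs]
    change (R ((1 + C * C) x), CFC.abs C (R ((1 + C * C) x))) = _
    rw [e1]
  rw [← LinearPMap.graph_absOp hcl, LinearPMap.mem_graph_iff] at hmem
  obtain ⟨y, hy1, hy2⟩ := hmem
  have : y = ⟨x, hx⟩ := Subtype.ext hy1
  rw [← this, hy2]; rfl

/-! Write b = B^{1/2}, X = bAb and W = b|A|b. The closed operator Ab has a bounded extension, hence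
is everywhere defined, and so is |A|b, because |A| and A have equal norms pointwise. Both
differences in the theorem equal ½(|X| − W), so one estimate settles both signs.

Put Y = bA₊b and Z = bA₋b. Then X = Y − Z and W = Y + Z, so |X|² − W² = −2(YZ + ZY), and ZY is the
adjoint of YZ. Since A₊A₋ = 0, the product YZ equals ([b, A₊]b² − [b³, A₊]) A₋b: the two terms A₊b³
cancel and b³A₊A₋b vanishes. Hölder with 3/(2p) + 1/(2p) = 2/p gives μ(t, YZ) = o(t^{-2/p})
(`singularValuesLittleO_posPart_mul_negPart`).

It remains to extract square roots (`singularValuesLittleO_sub_of_sq_sub_sq`): for P, Q ≥ 0, if P² −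
Q² has singular values o(t^{-2/p}), then J = P − Q has singular values o(t^{-1/p}). The operator J
solves PJ + JQ = D with D = P² − Q². With the Cayley function c(x) = (1 − hx)/(1 + hx), the
difference J − c(P)Jc(Q) is 2h(1 + hP)⁻¹D(1 + hQ)⁻¹, whose singular values are at most 2h times
those of D. Composing such steps over dyadic scales h yields a function f with |f(x)|x small on the
spectra, so f(P)Jf(Q) has small norm, while the accumulated errors are controlled by a convergent
series.

Membership in the closure of the finite rank operators is treated throughout as the decay condition
μ(t, T) = o(t^{-1/p}). -/

open Filter Topology

/-! ### Operators of rank at most `t` -/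

/-- The operator `R` has finite rank, at most `t`. -/
def ContinuousLinearMap.RankLE {H : Type*} [NormedAddCommGroup H] [InnerProductSpace ℂ H]
    (R : H →L[ℂ] H) (t : ℝ) : Prop :=
  Module.Finite ℂ (LinearMap.range R.toLinearMap) ∧
    (Module.finrank ℂ (LinearMap.range R.toLinearMap) : ℝ) ≤ t

namespace ContinuousLinearMap.RankLE

variable {H : Type*} [NormedAddCommGroup H] [InnerProductSpace ℂ H]

theorem zero {t : ℝ} (ht : 0 ≤ t) : (0 : H →L[ℂ] H).RankLE t := by
  have h : LinearMap.range (0 : H →L[ℂ] H).toLinearMap = ⊥ := LinearMap.range_zero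
  rw [ContinuousLinearMap.RankLE, h]
  refine ⟨inferInstance, ?_⟩
  simpa using ht

theorem of_range_le {R S : H →L[ℂ] H} {t : ℝ} (hR : R.RankLE t)
    (h : LinearMap.range S.toLinearMap ≤ LinearMap.range R.toLinearMap) : S.RankLE t := by
  have := hR.1
  refine ⟨Submodule.finiteDimensional_of_le h, le_trans ?_ hR.2⟩
  exact_mod_cast Submodule.finrank_mono h

theorem of_range_le_map {R S T : H →L[ℂ] H} {t : ℝ} (hR : R.RankLE t)
    (h : LinearMap.range S.toLinearMap ≤ (LinearMap.range R.toLinearMap).map T.toLinearMap) :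
    S.RankLE t := by
  have := hR.1
  refine ⟨Submodule.finiteDimensional_of_le h, le_trans ?_ hR.2⟩
  exact_mod_cast (Submodule.finrank_mono h).trans (Submodule.finrank_map_le _ _)

theorem add {R S : H →L[ℂ] H} {s t : ℝ} (hR : R.RankLE s) (hS : S.RankLE t) :
    (R + S).RankLE (s + t) := by
  have := hR.1
  have := hS.1
  have h : LinearMap.range (R + S).toLinearMap ≤
      LinearMap.range R.toLinearMap ⊔ LinearMap.range S.toLinearMap :=
    LinearMap.range_add_le _ _
  refine ⟨Submodule.finiteDimensional_of_le h, le_trans ?_ (add_le_add hR.2 hS.2)⟩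
  exact_mod_cast (Submodule.finrank_mono h).trans
    (Submodule.finrank_add_le_finrank_add_finrank _ _)

theorem mul_right {R : H →L[ℂ] H} {t : ℝ} (hR : R.RankLE t) (S : H →L[ℂ] H) :
    (R * S).RankLE t := by
  refine hR.of_range_le ?_
  rintro _ ⟨x, rfl⟩
  exact ⟨S x, rfl⟩

theorem mul_left {R : H →L[ℂ] H} {t : ℝ} (hR : R.RankLE t) (S : H →L[ℂ] H) :
    (S * R).RankLE t := by
  refine hR.of_range_le_map (T := S) ?_
  rintro _ ⟨x, rfl⟩
  exact ⟨R x, ⟨x, rfl⟩, rfl⟩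

theorem smul {R : H →L[ℂ] H} {t : ℝ} (hR : R.RankLE t) (c : ℂ) : (c • R).RankLE t := by
  refine hR.of_range_le ?_
  rintro _ ⟨x, rfl⟩
  exact ⟨c • x, R.map_smul c x⟩

theorem mono {R : H →L[ℂ] H} {s t : ℝ} (hR : R.RankLE s) (h : s ≤ t) : R.RankLE t :=
  ⟨hR.1, hR.2.trans h⟩

theorem isCompactOperator {R : H →L[ℂ] H} {t : ℝ} (hR : R.RankLE t) : IsCompactOperator R := by
  have := hR.1
  have : ProperSpace (LinearMap.range R.toLinearMap) := FiniteDimensional.proper ℂ _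
  have h : IsCompactOperator (R.codRestrict (LinearMap.range R.toLinearMap) fun x => ⟨x, rfl⟩) :=
    isCompactOperator_of_locallyCompactSpace_dom _
  exact h.clm_comp (LinearMap.range R.toLinearMap).subtypeL

variable [CompleteSpace H]

/-- The adjoint vanishes on the orthogonal complement of the range of R, so its range is the image
of that finite-dimensional range. -/
theorem adjoint {R : H →L[ℂ] H} {t : ℝ} (hR : R.RankLE t) : R.adjoint.RankLE t := by
  have := hR.1
  refine hR.of_range_le_map (T := R.adjoint) ?_
  rintro _ ⟨x, rfl⟩
  set K := LinearMap.range R.toLinearMap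
  refine ⟨K.starProjection x, Submodule.starProjection_apply_mem _ _, ?_⟩
  have h : x - K.starProjection x ∈ Kᗮ := Submodule.sub_starProjection_mem_orthogonal x
  have h2 : R.adjoint (x - K.starProjection x) = 0 := by
    apply ext_inner_left ℂ
    intro y
    rw [ContinuousLinearMap.adjoint_inner_right, inner_zero_right]
    exact h _ ⟨y, rfl⟩
  rw [map_sub, sub_eq_zero] at h2
  exact h2.symm

/-- The orthogonal projection along the kernel of a finite rank operator has the same rank. -/
theorem exists_projection {R : H →L[ℂ] H} {t : ℝ} (hR : R.RankLE t) :
    ∃ E : H →L[ℂ] H, E.RankLE t ∧ (∀ x, ‖x - E x‖ ≤ ‖x‖) ∧ ∀ x, R (x - E x) = 0 := by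
  set K := LinearMap.ker R.toLinearMap with hK
  have hKc : _root_.IsClosed (K : Set H) := R.isClosed_ker
  have : CompleteSpace K := hKc.completeSpace_coe
  have := hR.1
  refine ⟨1 - K.starProjection, ?_, fun x => ?_, fun x => ?_⟩
  · set E : H →L[ℂ] H := 1 - K.starProjection with hE
    have hRE : ∀ x, R (E x) = R x := fun x => by
      have : R (K.starProjection x) = 0 := Submodule.starProjection_apply_mem K x
      simp [hE, this]
    let f : LinearMap.range E.toLinearMap →ₗ[ℂ] LinearMap.range R.toLinearMap :=
      (R.toLinearMap.rangeRestrict).comp (LinearMap.range E.toLinearMap).subtype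
    -- R is injective on the range of E, because x and E x have the same image under R.
    have hf : Function.Injective f := by
      rw [← LinearMap.ker_eq_bot, LinearMap.ker_eq_bot']
      rintro ⟨_, x, rfl⟩ hx
      have h1 : R (E x) = 0 := congrArg Subtype.val hx
      have h2 : x ∈ K := by rw [hRE] at h1; exact h1
      refine Subtype.ext ?_
      change E x = 0
      have h3 : K.starProjection x = x := Submodule.starProjection_eq_self_iff.2 h2
      simp [hE, h3]
    exact ⟨Module.Finite.of_injective f hf, le_trans
      (by exact_mod_cast LinearMap.finrank_le_finrank_of_injective hf) hR.2⟩
  · simpa using K.norm_starProjection_apply_le x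
  · have : R (K.starProjection x) = 0 := Submodule.starProjection_apply_mem K x
    simpa using this

end ContinuousLinearMap.RankLE

/-! ### The singular value function -/

section SingularValues

variable {H : Type*} [NormedAddCommGroup H] [InnerProductSpace ℂ H]

theorem singularValueFun_le {T R : H →L[ℂ] H} {t : ℝ} (hR : R.RankLE t) :
    singularValueFun T t ≤ ‖T - R‖ := by
  refine csInf_le ⟨0, ?_⟩ ⟨R, hR.1, hR.2, rfl⟩
  rintro _ ⟨S, -, -, rfl⟩
  exact norm_nonneg _

theorem le_singularValueFun {T : H →L[ℂ] H} {t c : ℝ} (ht : 0 ≤ t)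
    (h : ∀ R : H →L[ℂ] H, R.RankLE t → c ≤ ‖T - R‖) : c ≤ singularValueFun T t := by
  refine le_csInf ⟨_, 0, (ContinuousLinearMap.RankLE.zero ht).1,
    (ContinuousLinearMap.RankLE.zero ht).2, rfl⟩ ?_
  rintro _ ⟨R, h1, h2, rfl⟩
  exact h R ⟨h1, h2⟩

theorem exists_norm_sub_lt {T : H →L[ℂ] H} {t c : ℝ} (ht : 0 ≤ t)
    (h : singularValueFun T t < c) : ∃ R : H →L[ℂ] H, R.RankLE t ∧ ‖T - R‖ < c := by
  by_contra! h'
  exact absurd (le_singularValueFun ht h') (not_le.2 h)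

theorem singularValueFun_nonneg (T : H →L[ℂ] H) (t : ℝ) : 0 ≤ singularValueFun T t := by
  refine Real.sInf_nonneg ?_
  rintro _ ⟨S, -, -, rfl⟩
  exact norm_nonneg _

theorem singularValueFun_le_norm (T : H →L[ℂ] H) {t : ℝ} (ht : 0 ≤ t) :
    singularValueFun T t ≤ ‖T‖ := by
  simpa using singularValueFun_le (T := T) (ContinuousLinearMap.RankLE.zero ht)

theorem singularValueFun_anti (T : H →L[ℂ] H) {s t : ℝ} (hs : 0 ≤ s) (h : s ≤ t) :
    singularValueFun T t ≤ singularValueFun T s :=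
  le_singularValueFun hs fun _ hR => singularValueFun_le (hR.mono h)

theorem singularValueFun_add_le (T S : H →L[ℂ] H) {s t : ℝ} (hs : 0 ≤ s) (ht : 0 ≤ t) :
    singularValueFun (T + S) (s + t) ≤ singularValueFun T s + singularValueFun S t := by
  refine le_of_forall_pos_le_add fun ε hε => ?_
  obtain ⟨R, hR, hR'⟩ := exists_norm_sub_lt hs (lt_add_of_pos_right (singularValueFun T s)
    (half_pos hε))
  obtain ⟨Q, hQ, hQ'⟩ := exists_norm_sub_lt ht (lt_add_of_pos_right (singularValueFun S t)
    (half_pos hε))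
  calc singularValueFun (T + S) (s + t) ≤ ‖T + S - (R + Q)‖ := singularValueFun_le (hR.add hQ)
    _ = ‖(T - R) + (S - Q)‖ := by congr 1; abel
    _ ≤ ‖T - R‖ + ‖S - Q‖ := norm_add_le _ _
    _ ≤ _ := by linarith

/-- The operator RS + (T − R)Q has rank at most s + t and misses TS by exactly (T − R)(S − Q). The
two infima are then taken one factor at a time. -/
theorem singularValueFun_mul_le (T S : H →L[ℂ] H) {s t : ℝ} (hs : 0 ≤ s) (ht : 0 ≤ t) :
    singularValueFun (T * S) (s + t) ≤ singularValueFun T s * singularValueFun S t := by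
  have key : ∀ R : H →L[ℂ] H, R.RankLE s → ∀ Q : H →L[ℂ] H, Q.RankLE t →
      singularValueFun (T * S) (s + t) ≤ ‖T - R‖ * ‖S - Q‖ := by
    intro R hR Q hQ
    have e : T * S - (R * S + (T - R) * Q) = (T - R) * (S - Q) := by noncomm_ring
    exact (singularValueFun_le ((hR.mul_right S).add (hQ.mul_left (T - R)))).trans
      (e ▸ norm_mul_le _ _)
  have h1 : ∀ R : H →L[ℂ] H, R.RankLE s →
      singularValueFun (T * S) (s + t) ≤ ‖T - R‖ * singularValueFun S t := by
    intro R hR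
    -- The infimum over Q is taken after dividing by this norm, so the value zero is treated apart.
    rcases (norm_nonneg (T - R)).eq_or_lt with h0 | h0
    · have := key R hR 0 (.zero ht)
      rw [← h0] at this ⊢
      simpa using this
    · rw [← div_le_iff₀' h0]
      refine le_singularValueFun ht fun Q hQ => ?_
      rw [div_le_iff₀' h0]
      exact key R hR Q hQ
  rcases (singularValueFun_nonneg S t).eq_or_lt with h0 | h0
  · have := h1 0 (.zero hs)
    rw [← h0] at this ⊢
    simpa using this
  · rw [← div_le_iff₀ h0]
    refine le_singularValueFun hs fun R hR => ?_
    rw [div_le_iff₀ h0]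
    exact h1 R hR

theorem singularValueFun_smul_le (T : H →L[ℂ] H) (c : ℂ) {t : ℝ} (ht : 0 ≤ t) :
    singularValueFun (c • T) t ≤ ‖c‖ * singularValueFun T t := by
  have key : ∀ R : H →L[ℂ] H, R.RankLE t → singularValueFun (c • T) t ≤ ‖c‖ * ‖T - R‖ := by
    intro R hR
    rw [← norm_smul, smul_sub]
    exact singularValueFun_le (hR.smul c)
  rcases (norm_nonneg c).eq_or_lt with h0 | h0
  · have := key 0 (.zero ht)
    rw [← h0] at this ⊢
    simpa using this
  · rw [← div_le_iff₀' h0]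
    refine le_singularValueFun ht fun R hR => ?_
    rw [div_le_iff₀' h0]
    exact key R hR

/-- An approximant R of T is replaced by the projection E along its kernel: on vectors x − E x the
operators T and T − R agree, so S − SE is dominated by T − R. -/
theorem singularValueFun_le_of_norm_apply_le [CompleteSpace H] {T S : H →L[ℂ] H}
    (h : ∀ x, ‖S x‖ ≤ ‖T x‖) {t : ℝ} (ht : 0 ≤ t) :
    singularValueFun S t ≤ singularValueFun T t := by
  refine le_singularValueFun ht fun R hR => ?_
  obtain ⟨E, hE, hE1, hE2⟩ := hR.exists_projection
  refine (singularValueFun_le (hE.mul_left S)).trans ?_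
  refine ContinuousLinearMap.opNorm_le_bound _ (norm_nonneg _) fun x => ?_
  calc ‖(S - S * E) x‖ = ‖S (x - E x)‖ := by simp
    _ ≤ ‖T (x - E x)‖ := h _
    _ = ‖(T - R) (x - E x)‖ := by rw [sub_apply, hE2, sub_zero]
    _ ≤ ‖T - R‖ * ‖x - E x‖ := ContinuousLinearMap.le_opNorm _ _
    _ ≤ _ := mul_le_mul_of_nonneg_left (hE1 x) (norm_nonneg _)

theorem singularValueFun_adjoint_le [CompleteSpace H] (T : H →L[ℂ] H) {t : ℝ} (ht : 0 ≤ t) :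
    singularValueFun T.adjoint t ≤ singularValueFun T t := by
  refine le_singularValueFun ht fun R hR => ?_
  refine (singularValueFun_le hR.adjoint).trans (le_of_eq ?_)
  rw [← map_sub]
  exact LinearIsometryEquiv.norm_map _ _

/-! ### Decay of singular values -/

/-- `μ(t, T) = o(t^{-1/p})` as `t → ∞`. -/
def SingularValuesLittleO (p : ℝ) (T : H →L[ℂ] H) : Prop :=
  Tendsto (fun t : ℝ => t ^ (1 / p) * singularValueFun T t) atTop (𝓝 0)

/-- `μ(t, T) = O(t^{-1/p})`. -/
def SingularValuesBigO (p : ℝ) (T : H →L[ℂ] H) : Prop :=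
  ∃ C : ℝ, ∀ t : ℝ, 0 ≤ t → t ^ (1 / p) * singularValueFun T t ≤ C

theorem weakSchattenNorm_le_iff {p c : ℝ} (hc : 0 ≤ c) {T : H →L[ℂ] H} :
    weakSchattenNorm p T ≤ ENNReal.ofReal c ↔
      ∀ t : ℝ, 0 ≤ t → t ^ (1 / p) * singularValueFun T t ≤ c := by
  rw [weakSchattenNorm, iSup_le_iff]
  constructor
  · intro h t ht
    exact (ENNReal.ofReal_le_ofReal_iff hc).1 (h ⟨t, ht⟩)
  · intro h t
    exact ENNReal.ofReal_le_ofReal (h t t.2)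

theorem singularValuesBigO_of_mem_weakSchatten {p : ℝ} {T : H →L[ℂ] H}
    (hT : T ∈ weakSchatten H p) : SingularValuesBigO p T := by
  refine ⟨(weakSchattenNorm p T).toReal, (weakSchattenNorm_le_iff ENNReal.toReal_nonneg).1 ?_⟩
  rw [ENNReal.ofReal_toReal hT.2.ne]

theorem tendsto_zero_of_eventually_le {f : ℝ → ℝ} (h0 : ∀ t, 0 ≤ t → 0 ≤ f t)
    (h : ∀ ε : ℝ, 0 < ε → ∀ᶠ t in atTop, f t ≤ ε) : Tendsto f atTop (𝓝 0) := by
  rw [Metric.tendsto_nhds]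
  intro ε hε
  filter_upwards [h (ε / 2) (half_pos hε), eventually_ge_atTop 0] with t ht ht0
  rw [Real.dist_eq, sub_zero, abs_of_nonneg (h0 t ht0)]
  linarith

theorem singularValuesLittleO_of_eventually {p : ℝ} {T : H →L[ℂ] H}
    (h : ∀ ε : ℝ, 0 < ε → ∀ᶠ t : ℝ in atTop, t ^ (1 / p) * singularValueFun T t ≤ ε) :
    SingularValuesLittleO p T :=
  tendsto_zero_of_eventually_le
    (fun _ ht => mul_nonneg (Real.rpow_nonneg ht _) (singularValueFun_nonneg _ _)) h

/-- Subtracting a fixed operator of rank r shifts the argument of μ by r, which for t ≥ 2r costs no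
more than passing from t to t/2. -/
theorem singularValuesLittleO_of_mem_weakSchattenZero {p : ℝ} {T : H →L[ℂ] H}
    (hT : T ∈ weakSchattenZero H p) : SingularValuesLittleO p T := by
  refine singularValuesLittleO_of_eventually fun ε hε => ?_
  have hc : 0 < (2 : ℝ) ^ (1 / p) := by positivity
  -- The divisor compensates for the factor lost in replacing t by t/2.
  obtain ⟨F, hF, hF2⟩ := hT.2 (ε / 2 ^ (1 / p)) (by positivity)
  have h1 := (weakSchattenNorm_le_iff (by positivity)).1 hF2.le
  set r : ℝ := (Module.finrank ℂ (LinearMap.range F.toLinearMap) : ℝ)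
  have hr : 0 ≤ r := Nat.cast_nonneg _
  have hFr : F.RankLE r := ⟨hF, le_rfl⟩
  have hF0 : singularValueFun F r ≤ 0 := by simpa using singularValueFun_le (T := F) hFr
  filter_upwards [eventually_ge_atTop (2 * r)] with t ht
  have ht2 : 0 ≤ t / 2 := by linarith
  have h2 : singularValueFun T t ≤ singularValueFun (T - F) (t / 2) := by
    calc singularValueFun T t ≤ singularValueFun (T - F + F) (t / 2 + r) := by
          rw [sub_add_cancel]
          exact singularValueFun_anti T (by linarith) (by linarith)
      _ ≤ _ := singularValueFun_add_le _ _ ht2 hr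
      _ ≤ _ := by linarith
  have h3 : t ^ (1 / p) = 2 ^ (1 / p) * (t / 2) ^ (1 / p) := by
    rw [← Real.mul_rpow (by norm_num) ht2]; congr 1; ring
  calc t ^ (1 / p) * singularValueFun T t
      ≤ t ^ (1 / p) * singularValueFun (T - F) (t / 2) :=
        mul_le_mul_of_nonneg_left h2 (Real.rpow_nonneg (by linarith) _)
    _ = 2 ^ (1 / p) * ((t / 2) ^ (1 / p) * singularValueFun (T - F) (t / 2)) := by
        rw [h3]; ring
    _ ≤ 2 ^ (1 / p) * (ε / 2 ^ (1 / p)) := mul_le_mul_of_nonneg_left (h1 _ ht2) hc.le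
    _ = ε := by field_simp

theorem SingularValuesLittleO.bigO {p : ℝ} (hp : 0 < p) {T : H →L[ℂ] H}
    (hT : SingularValuesLittleO p T) : SingularValuesBigO p T := by
  obtain ⟨a, ha⟩ := eventually_atTop.1 (hT.eventually_le_const one_pos)
  refine ⟨max 1 (|a| ^ (1 / p) * ‖T‖), fun t ht => ?_⟩
  rcases le_total a t with h | h
  · exact (ha t h).trans (le_max_left _ _)
  · refine le_trans ?_ (le_max_right _ _)
    have : t ≤ |a| := h.trans (le_abs_self a)
    have := singularValueFun_nonneg T t
    have := singularValueFun_le_norm T ht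
    gcongr

/-- For t ≥ 1 the weight t^{1/p} is at least 1, so the singular values themselves tend to 0 and T is
a norm limit of finite rank operators. -/
theorem SingularValuesLittleO.isCompactOperator [CompleteSpace H] {p : ℝ} (hp : 0 < p)
    {T : H →L[ℂ] H} (hT : SingularValuesLittleO p T) : IsCompactOperator T := by
  have hcl := isClosed_setOfPred_isCompactOperator (σ₁₂ := RingHom.id ℂ) (M₁ := H) (M₂ := H)
  have hmem : T ∈ closure {f : H →L[ℂ] H | IsCompactOperator f} := by
    rw [Metric.mem_closure_iff]
    intro ε hε
    obtain ⟨t, ht, ht1⟩ := ((hT.eventually_lt_const hε).and (eventually_ge_atTop 1)).exists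
    have h1 : singularValueFun T t < ε := by
      refine lt_of_le_of_lt (le_mul_of_one_le_left (singularValueFun_nonneg _ _) ?_) ht
      exact Real.one_le_rpow ht1 (by positivity)
    obtain ⟨R, hR, hR'⟩ := exists_norm_sub_lt (by linarith) h1
    exact ⟨R, hR.isCompactOperator, by rwa [dist_eq_norm]⟩
  exact hcl.closure_subset hmem

/-- A near-optimal approximant F of rank at most n serves for all t at once: below 2n the norm of T
− F suffices, and above 2n the rank of F is absorbed into t/2. -/
theorem SingularValuesLittleO.mem_weakSchattenZero [CompleteSpace H] {p : ℝ} (hp : 0 < p)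
    {T : H →L[ℂ] H} (hT : SingularValuesLittleO p T) : T ∈ weakSchattenZero H p := by
  refine ⟨⟨hT.isCompactOperator hp, ?_⟩, fun ε hε => ?_⟩
  · obtain ⟨C, hC⟩ := hT.bigO hp
    have hC0 : 0 ≤ C :=
      (mul_nonneg (Real.rpow_nonneg le_rfl _) (singularValueFun_nonneg T 0)).trans (hC 0 le_rfl)
    exact ((weakSchattenNorm_le_iff hC0).2 hC).trans_lt ENNReal.ofReal_lt_top
  · have hc : 0 < (2 : ℝ) ^ (1 / p) := by positivity
    set δ := ε / 2 / 2 ^ (1 / p) with hδ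
    have hδ0 : 0 < δ := by positivity
    obtain ⟨a, ha⟩ := eventually_atTop.1 (hT.eventually_lt_const hδ0)
    set n := max a 1
    have hn : 0 < n := lt_of_lt_of_le one_pos (le_max_right _ _)
    have hnp : 0 < n ^ (1 / p) := Real.rpow_pos_of_pos hn _
    have h1 : singularValueFun T n < δ / n ^ (1 / p) := by
      rw [lt_div_iff₀' hnp]
      exact ha n (le_max_left _ _)
    obtain ⟨F, hF, hF'⟩ := exists_norm_sub_lt hn.le h1
    refine ⟨F, hF.1, lt_of_le_of_lt ((weakSchattenNorm_le_iff (c := ε / 2) (by positivity)).2 ?_)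
      ((ENNReal.ofReal_lt_ofReal_iff hε).2 (half_lt_self hε))⟩
    have hεδ : ε / 2 = 2 ^ (1 / p) * δ := by rw [hδ]; field_simp
    intro t ht
    rcases le_total t (2 * n) with h | h
    · calc t ^ (1 / p) * singularValueFun (T - F) t
          ≤ (2 * n) ^ (1 / p) * (δ / n ^ (1 / p)) := by
            have h2 := singularValueFun_le_norm (T - F) ht
            have := singularValueFun_nonneg (T - F) t
            gcongr
            linarith
        _ = ε / 2 := by
            rw [Real.mul_rpow (by norm_num) hn.le, hεδ]; field_simp
    · have ht2 : 0 ≤ t / 2 := by linarith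
      have h2 : singularValueFun (T - F) t ≤ singularValueFun T (t / 2) := by
        refine le_singularValueFun ht2 fun R hR => ?_
        have h3 : (R + (-1 : ℂ) • F).RankLE t := (hR.add (hF.smul (-1))).mono (by linarith)
        refine (singularValueFun_le h3).trans (le_of_eq ?_)
        congr 1
        rw [neg_one_smul]
        abel
      have h3 : t ^ (1 / p) = 2 ^ (1 / p) * (t / 2) ^ (1 / p) := by
        rw [← Real.mul_rpow (by norm_num) ht2]; congr 1; ring
      have h4 := (ha (t / 2) ((le_max_left a 1).trans (by linarith))).le
      calc t ^ (1 / p) * singularValueFun (T - F) t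
          ≤ t ^ (1 / p) * singularValueFun T (t / 2) :=
            mul_le_mul_of_nonneg_left h2 (Real.rpow_nonneg ht _)
        _ = 2 ^ (1 / p) * ((t / 2) ^ (1 / p) * singularValueFun T (t / 2)) := by rw [h3]; ring
        _ ≤ ε / 2 := by rw [hεδ]; gcongr

/-! ### Stability of the decay conditions under algebraic operations -/

theorem singularValueFun_half_tendsto {p : ℝ} {T : H →L[ℂ] H} (hT : SingularValuesLittleO p T) :
    Tendsto (fun t : ℝ => (t / 2) ^ (1 / p) * singularValueFun T (t / 2)) atTop (𝓝 0) :=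
  Tendsto.comp hT (tendsto_id.atTop_div_const two_pos)

theorem SingularValuesLittleO.add {p : ℝ} {T S : H →L[ℂ] H}
    (hT : SingularValuesLittleO p T) (hS : SingularValuesLittleO p S) :
    SingularValuesLittleO p (T + S) := by
  have h := ((singularValueFun_half_tendsto hT).add
    (singularValueFun_half_tendsto hS)).const_mul ((2 : ℝ) ^ (1 / p))
  rw [add_zero, mul_zero] at h
  refine squeeze_zero' ?_ ?_ h
  · filter_upwards [eventually_ge_atTop 0] with t ht
    exact mul_nonneg (Real.rpow_nonneg ht _) (singularValueFun_nonneg _ _)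
  · filter_upwards [eventually_ge_atTop 0] with t ht
    have ht2 : 0 ≤ t / 2 := by linarith
    have h2 := singularValueFun_add_le T S ht2 ht2
    rw [add_halves] at h2
    rw [← mul_add, ← mul_assoc, ← Real.mul_rpow two_pos.le ht2,
      mul_div_cancel₀ t two_ne_zero]
    exact mul_le_mul_of_nonneg_left h2 (Real.rpow_nonneg ht _)

theorem SingularValuesLittleO.smul {p : ℝ} {T : H →L[ℂ] H}
    (hT : SingularValuesLittleO p T) (c : ℂ) : SingularValuesLittleO p (c • T) := by
  have h := Tendsto.const_mul ‖c‖ hT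
  rw [mul_zero] at h
  refine squeeze_zero' ?_ ?_ h
  · filter_upwards [eventually_ge_atTop 0] with t ht
    exact mul_nonneg (Real.rpow_nonneg ht _) (singularValueFun_nonneg _ _)
  · filter_upwards [eventually_ge_atTop 0] with t ht
    calc t ^ (1 / p) * singularValueFun (c • T) t
        ≤ t ^ (1 / p) * (‖c‖ * singularValueFun T t) :=
          mul_le_mul_of_nonneg_left (singularValueFun_smul_le T c ht) (Real.rpow_nonneg ht _)
      _ = _ := by ring

theorem SingularValuesLittleO.adjoint [CompleteSpace H] {p : ℝ} {T : H →L[ℂ] H}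
    (hT : SingularValuesLittleO p T) : SingularValuesLittleO p T.adjoint := by
  refine squeeze_zero' ?_ ?_ hT
  · filter_upwards [eventually_ge_atTop 0] with t ht
    exact mul_nonneg (Real.rpow_nonneg ht _) (singularValueFun_nonneg _ _)
  · filter_upwards [eventually_ge_atTop 0] with t ht
    exact mul_le_mul_of_nonneg_left (singularValueFun_adjoint_le T ht) (Real.rpow_nonneg ht _)

theorem SingularValuesBigO.of_norm_apply_le [CompleteSpace H] {p : ℝ} {T S : H →L[ℂ] H}
    (hT : SingularValuesBigO p T) (h : ∀ x, ‖S x‖ ≤ ‖T x‖) : SingularValuesBigO p S := by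
  obtain ⟨C, hC⟩ := hT
  exact ⟨C, fun t ht => (mul_le_mul_of_nonneg_left (singularValueFun_le_of_norm_apply_le h ht)
    (Real.rpow_nonneg ht _)).trans (hC t ht)⟩

/-- Hölder's inequality for the decay of singular values of a product. -/
theorem SingularValuesLittleO.mul_bigO {p q r : ℝ} (hpqr : 1 / p + 1 / q = 1 / r)
    {T S : H →L[ℂ] H} (hT : SingularValuesLittleO p T) (hS : SingularValuesBigO q S) :
    SingularValuesLittleO r (T * S) := by
  obtain ⟨C, hC⟩ := hS
  have h := (singularValueFun_half_tendsto hT).const_mul ((2 : ℝ) ^ (1 / r) * C)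
  rw [mul_zero] at h
  refine squeeze_zero' ?_ ?_ h
  · filter_upwards [eventually_ge_atTop 0] with t ht
    exact mul_nonneg (Real.rpow_nonneg ht _) (singularValueFun_nonneg _ _)
  · filter_upwards [eventually_gt_atTop 0] with t ht
    have ht2 : 0 < t / 2 := by linarith
    have h2 := singularValueFun_mul_le T S ht2.le ht2.le
    rw [add_halves] at h2
    have h3 : t ^ (1 / r) = 2 ^ (1 / r) * ((t / 2) ^ (1 / p) * (t / 2) ^ (1 / q)) := by
      rw [← Real.rpow_add ht2, hpqr, ← Real.mul_rpow two_pos.le ht2.le,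
        mul_div_cancel₀ t two_ne_zero]
    calc t ^ (1 / r) * singularValueFun (T * S) t
        ≤ t ^ (1 / r) * (singularValueFun T (t / 2) * singularValueFun S (t / 2)) :=
          mul_le_mul_of_nonneg_left h2 (Real.rpow_nonneg ht.le _)
      _ = 2 ^ (1 / r) * ((t / 2) ^ (1 / p) * singularValueFun T (t / 2)) *
            ((t / 2) ^ (1 / q) * singularValueFun S (t / 2)) := by rw [h3]; ring
      _ ≤ 2 ^ (1 / r) * ((t / 2) ^ (1 / p) * singularValueFun T (t / 2)) * C := by
          have := singularValueFun_nonneg T (t / 2)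
          exact mul_le_mul_of_nonneg_left (hC _ ht2.le) (by positivity)
      _ = _ := by ring

end SingularValues

/-! ### Perturbation of square roots -/

section SquareRoot

variable {H : Type*} [NormedAddCommGroup H] [InnerProductSpace ℂ H] [CompleteSpace H]

theorem continuousOn_spectrum_of_nonneg {P : H →L[ℂ] H} (hP : 0 ≤ P) {f : ℝ → ℝ}
    (hf : ContinuousOn f (Set.Ici 0)) : ContinuousOn f (spectrum ℝ P) :=
  hf.mono fun _ hx => spectrum_nonneg_of_nonneg hP hx

theorem norm_cfc_le_one_of_nonneg {P : H →L[ℂ] H} (hP : 0 ≤ P) {f : ℝ → ℝ}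
    (hf : ∀ x, 0 ≤ x → |f x| ≤ 1) : ‖cfc f P‖ ≤ 1 :=
  norm_cfc_le zero_le_one fun x hx => hf x (spectrum_nonneg_of_nonneg hP hx)

/-- The function `f` is a contraction on `[0, ∞)` and `f(P) J f(Q)` approximates `J` up to an
operator whose singular value at `s` is at most `e`. -/
structure TwoSidedApprox (P Q J : H →L[ℂ] H) (f : ℝ → ℝ) (s e : ℝ) : Prop where
  cont : ContinuousOn f (Set.Ici 0)
  bound : ∀ x, 0 ≤ x → |f x| ≤ 1
  nonneg : 0 ≤ s
  approx : singularValueFun (J - cfc f P * J * cfc f Q) s ≤ e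

theorem norm_mul_mul_le_of_contraction {a b T : H →L[ℂ] H} (ha : ‖a‖ ≤ 1) (hb : ‖b‖ ≤ 1) :
    ‖a * T * b‖ ≤ ‖T‖ := by
  calc ‖a * T * b‖ ≤ ‖a‖ * ‖T‖ * ‖b‖ := norm_mul₃_le
    _ ≤ 1 * ‖T‖ * 1 := by gcongr
    _ = ‖T‖ := by ring

theorem singularValueFun_contraction_le {a b T : H →L[ℂ] H} (ha : ‖a‖ ≤ 1) (hb : ‖b‖ ≤ 1) {t : ℝ}
    (ht : 0 ≤ t) : singularValueFun (a * T * b) t ≤ singularValueFun T t := by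
  refine le_singularValueFun ht fun R hR => ?_
  refine (singularValueFun_le ((hR.mul_left a).mul_right b)).trans ?_
  have e : a * T * b - a * R * b = a * (T - R) * b := by noncomm_ring
  rw [e]
  exact norm_mul_mul_le_of_contraction ha hb

theorem TwoSidedApprox.one {P Q : H →L[ℂ] H} (hP : 0 ≤ P) (hQ : 0 ≤ Q) (J : H →L[ℂ] H) :
    TwoSidedApprox P Q J (fun _ => 1) 0 0 where
  cont := continuousOn_const
  bound := fun x _ => by simp
  nonneg := le_rfl
  approx := by
    rw [cfc_const_one ℝ P, cfc_const_one ℝ Q, one_mul, mul_one, sub_self]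
    simpa using singularValueFun_le_norm (0 : H →L[ℂ] H) le_rfl

/-- The error telescopes as J − f(P)Jf(Q) plus f(P)(J − g(P)Jg(Q))f(Q). The outer factors of the
second term are contractions, so ranks and errors simply add. -/
theorem TwoSidedApprox.mul {P Q J : H →L[ℂ] H} (hP : 0 ≤ P) (hQ : 0 ≤ Q) {f g : ℝ → ℝ}
    {s t d e : ℝ} (hf : TwoSidedApprox P Q J f s d) (hg : TwoSidedApprox P Q J g t e) :
    TwoSidedApprox P Q J (fun x => f x * g x) (s + t) (d + e) where
  cont := hf.cont.mul hg.cont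
  bound := fun x hx => by
    rw [abs_mul]
    exact mul_le_one₀ (hf.bound x hx) (abs_nonneg _) (hg.bound x hx)
  nonneg := add_nonneg hf.nonneg hg.nonneg
  approx := by
    have hfP := continuousOn_spectrum_of_nonneg hP hf.cont
    have hfQ := continuousOn_spectrum_of_nonneg hQ hf.cont
    have hgP := continuousOn_spectrum_of_nonneg hP hg.cont
    have hgQ := continuousOn_spectrum_of_nonneg hQ hg.cont
    have e1 : cfc (fun x => f x * g x) Q = cfc g Q * cfc f Q := by
      rw [← cfc_mul g f Q]; simp_rw [mul_comm]
    have e2 : J - cfc (fun x => f x * g x) P * J * cfc (fun x => f x * g x) Q =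
        (J - cfc f P * J * cfc f Q) + cfc f P * (J - cfc g P * J * cfc g Q) * cfc f Q := by
      rw [e1, cfc_mul f g P]; noncomm_ring
    rw [e2]
    exact (singularValueFun_add_le _ _ hf.nonneg hg.nonneg).trans (add_le_add hf.approx
      ((singularValueFun_contraction_le (norm_cfc_le_one_of_nonneg hP hf.bound)
        (norm_cfc_le_one_of_nonneg hQ hf.bound) hg.nonneg).trans hg.approx))

theorem TwoSidedApprox.pow {P Q J : H →L[ℂ] H} (hP : 0 ≤ P) (hQ : 0 ≤ Q) {f : ℝ → ℝ}
    {s e : ℝ} (hf : TwoSidedApprox P Q J f s e) (n : ℕ) :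
    TwoSidedApprox P Q J (fun x => f x ^ n) (n * s) (n * e) := by
  induction n with
  | zero => simpa using TwoSidedApprox.one hP hQ J
  | succ n ih =>
    have := ih.mul hP hQ hf
    simp only [← pow_succ] at this
    push_cast
    rwa [add_mul, one_mul, add_mul, one_mul]

theorem TwoSidedApprox.prod {P Q J : H →L[ℂ] H} (hP : 0 ≤ P) (hQ : 0 ≤ Q) {f : ℕ → ℝ → ℝ}
    {s e : ℕ → ℝ} (hf : ∀ j, TwoSidedApprox P Q J (f j) (s j) (e j)) (m : ℕ) :
    TwoSidedApprox P Q J (fun x => ∏ j ∈ Finset.range m, f j x) (∑ j ∈ Finset.range m, s j)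
      (∑ j ∈ Finset.range m, e j) := by
  induction m with
  | zero => simpa using TwoSidedApprox.one hP hQ J
  | succ m ih =>
    simp only [Finset.prod_range_succ, Finset.sum_range_succ]
    exact ih.mul hP hQ (hf m)

/-! ### Cayley transforms and the Sylvester equation -/

theorem continuousOn_inv_one_add_mul {h : ℝ} (hh : 0 < h) :
    ContinuousOn (fun x : ℝ => (1 + h * x)⁻¹) (Set.Ici 0) := by
  refine ContinuousOn.inv₀ (by fun_prop) fun x hx => ?_
  have : 0 ≤ h * x := mul_nonneg hh.le hx
  positivity

theorem cfc_inv_one_add_mul {P : H →L[ℂ] H} (hP : 0 ≤ P) {h : ℝ} (hh : 0 < h) :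
    h • (cfc (fun x : ℝ => (1 + h * x)⁻¹) P * P) = 1 - cfc (fun x : ℝ => (1 + h * x)⁻¹) P ∧
    h • (P * cfc (fun x : ℝ => (1 + h * x)⁻¹) P) = 1 - cfc (fun x : ℝ => (1 + h * x)⁻¹) P := by
  have hc := continuousOn_spectrum_of_nonneg hP (continuousOn_inv_one_add_mul hh)
  have hsa : IsSelfAdjoint P := IsSelfAdjoint.of_nonneg hP
  have hcomm : Commute (cfc (fun x : ℝ => (1 + h * x)⁻¹) P) P := by
    have := cfc_commute_cfc (fun x : ℝ => (1 + h * x)⁻¹) (fun x => x) P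
    rwa [cfc_id' ℝ P] at this
  have key : h • (cfc (fun x : ℝ => (1 + h * x)⁻¹) P * P) =
      1 - cfc (fun x : ℝ => (1 + h * x)⁻¹) P := by
    have e1 : cfc (fun x : ℝ => (1 + h * x)⁻¹) P * P =
        cfc (fun x : ℝ => (1 + h * x)⁻¹ * x) P := by
      rw [cfc_mul (fun x : ℝ => (1 + h * x)⁻¹) (fun x => x) P hc (by fun_prop), cfc_id' ℝ P]
    have e2 : (1 : H →L[ℂ] H) - cfc (fun x : ℝ => (1 + h * x)⁻¹) P =
        cfc (fun x : ℝ => 1 - (1 + h * x)⁻¹) P := by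
      rw [cfc_sub (fun _ => 1) (fun x : ℝ => (1 + h * x)⁻¹) P (by fun_prop) hc,
        cfc_const_one ℝ P]
    rw [e1, e2, ← cfc_const_mul h (fun x : ℝ => (1 + h * x)⁻¹ * x) P (hc.mul continuousOn_id)]
    refine cfc_congr fun x hx => ?_
    have hx0 : 0 ≤ x := spectrum_nonneg_of_nonneg hP hx
    have : 1 + h * x ≠ 0 := by positivity
    field_simp
    ring
  exact ⟨key, by rw [← hcomm.eq, key]⟩

/-- One step of the Cayley iteration for the Sylvester equation `P J + J Q = D`. -/
theorem TwoSidedApprox.cayley {P Q J D : H →L[ℂ] H} (hP : 0 ≤ P) (hQ : 0 ≤ Q)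
    (hD : P * J + J * Q = D) {h : ℝ} (hh : 0 < h) {t : ℝ} (ht : 0 ≤ t) :
    TwoSidedApprox P Q J (fun x => (1 - h * x) * (1 + h * x)⁻¹) t
      (2 * h * singularValueFun D t) where
  cont := ContinuousOn.mul (by fun_prop) (continuousOn_inv_one_add_mul hh)
  bound := fun x hx => by
    have h1 : 0 ≤ h * x := mul_nonneg hh.le hx
    have h2 : 0 < 1 + h * x := by positivity
    rw [← div_eq_mul_inv, abs_div, abs_of_pos h2, div_le_one h2, abs_le]
    constructor <;> linarith
  nonneg := ht
  approx := by
    -- The Cayley function is 2(1 + hx)⁻¹ − 1, which reduces the step to resolvents.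
    have hcay : ∀ R : H →L[ℂ] H, 0 ≤ R → cfc (fun x : ℝ => (1 - h * x) * (1 + h * x)⁻¹) R =
        (2 : ℝ) • cfc (fun x : ℝ => (1 + h * x)⁻¹) R - 1 := by
      intro R hR
      have hc := continuousOn_spectrum_of_nonneg hR (continuousOn_inv_one_add_mul hh)
      have hsa : IsSelfAdjoint R := IsSelfAdjoint.of_nonneg hR
      rw [← cfc_const_mul (2 : ℝ) _ R hc, ← cfc_const_one ℝ R,
        ← cfc_sub (fun x : ℝ => 2 * (1 + h * x)⁻¹) (fun _ => 1) R (by fun_prop) (by fun_prop)]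
      refine cfc_congr fun x hx => ?_
      have hx0 : 0 ≤ x := spectrum_nonneg_of_nonneg hR hx
      have : 1 + h * x ≠ 0 := by positivity
      field_simp
      ring
    rw [hcay P hP, hcay Q hQ]
    have ha := (cfc_inv_one_add_mul hP hh).1
    have hb := (cfc_inv_one_add_mul hQ hh).2
    have hna : ‖cfc (fun x : ℝ => (1 + h * x)⁻¹) P‖ ≤ 1 ∧
        ‖cfc (fun x : ℝ => (1 + h * x)⁻¹) Q‖ ≤ 1 := by
      have hb : ∀ x : ℝ, 0 ≤ x → |(1 + h * x)⁻¹| ≤ 1 := by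
        intro x hx
        have h1 : 0 ≤ h * x := mul_nonneg hh.le hx
        rw [abs_of_pos (by positivity)]
        exact inv_le_one_of_one_le₀ (by linarith)
      exact ⟨norm_cfc_le_one_of_nonneg hP hb, norm_cfc_le_one_of_nonneg hQ hb⟩
    set a := cfc (fun x : ℝ => (1 + h * x)⁻¹) P
    set b := cfc (fun x : ℝ => (1 + h * x)⁻¹) Q
    -- With haP = 1 − a and hQb = 1 − b, the right side becomes 2((1 − a)Jb + aJ(1 − b)), which
    -- expands to the left side.
    have e : J - ((2 : ℝ) • a - 1) * J * ((2 : ℝ) • b - 1) =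
        ((2 * h : ℝ) : ℂ) • (a * D * b) := by
      rw [← hD]
      have e1 : ((2 * h : ℝ) : ℂ) • (a * (P * J + J * Q) * b) =
          (2 : ℝ) • ((h • (a * P)) * J * b + a * J * (h • (Q * b))) := by
        simp only [mul_add, add_mul, smul_mul_assoc, mul_smul_comm, smul_add, smul_smul,
          mul_assoc, Complex.coe_smul]
      rw [e1, ha, hb]
      simp only [two_smul]
      noncomm_ring
    rw [e]
    refine (singularValueFun_smul_le _ _ ht).trans ?_
    rw [Complex.norm_real, Real.norm_of_nonneg (by positivity)]
    exact mul_le_mul_of_nonneg_left (singularValueFun_contraction_le hna.1 hna.2 ht)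
      (by positivity)

/-- The error bound for the approximant `f(P) (P - Q) f(Q)`. -/
theorem TwoSidedApprox.singularValueFun_le {P Q : H →L[ℂ] H} (hP : 0 ≤ P) (hQ : 0 ≤ Q)
    {f : ℝ → ℝ} {s e c M : ℝ} (hf : TwoSidedApprox P Q (P - Q) f s e) (hc : 0 ≤ c)
    (hPM : ‖P‖ ≤ M) (hQM : ‖Q‖ ≤ M) (hfc : ∀ x, 0 ≤ x → x ≤ M → |f x| * x ≤ c) :
    singularValueFun (P - Q) s ≤ e + 2 * c := by
  have key : ∀ R : H →L[ℂ] H, 0 ≤ R → ‖R‖ ≤ M → ‖cfc f R * R‖ ≤ c ∧ ‖R * cfc f R‖ ≤ c := by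
    intro R hR hRM
    have hsa : IsSelfAdjoint R := IsSelfAdjoint.of_nonneg hR
    have hc' := continuousOn_spectrum_of_nonneg hR hf.cont
    have hcomm : Commute (cfc f R) R := by
      have := cfc_commute_cfc f (fun x => x) R
      rwa [cfc_id' ℝ R] at this
    have h1 : ‖cfc f R * R‖ ≤ c := by
      have e1 : cfc f R * R = cfc (fun x => f x * x) R := by
        rw [cfc_mul f (fun x => x) R hc' (by fun_prop), cfc_id' ℝ R]
      rw [e1]
      refine norm_cfc_le hc fun x hx => ?_
      have hx0 : 0 ≤ x := spectrum_nonneg_of_nonneg hR hx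
      rw [norm_mul, Real.norm_eq_abs, Real.norm_of_nonneg hx0]
      refine hfc x hx0 (le_trans ?_ hRM)
      -- Bounding the spectrum by the norm needs ‖1‖ = 1. On the zero space the spectrum is empty.
      rcases subsingleton_or_nontrivial H with hH | hH
      · have : Subsingleton (H →L[ℂ] H) := inferInstance
        rw [spectrum.of_subsingleton] at hx
        exact absurd hx (Set.notMem_empty x)
      · exact (Real.le_norm_self x).trans (spectrum.norm_le_norm_of_mem hx)
    exact ⟨h1, by rwa [← hcomm.eq]⟩
  have hfP := norm_cfc_le_one_of_nonneg hP hf.bound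
  have hfQ := norm_cfc_le_one_of_nonneg hQ hf.bound
  -- Each of P and Q is absorbed by the neighbouring function of itself, where |f(x)|x ≤ c applies.
  have h1 : ‖cfc f P * (P - Q) * cfc f Q‖ ≤ 2 * c := by
    have e1 : cfc f P * (P - Q) * cfc f Q =
        (cfc f P * P) * cfc f Q - cfc f P * (Q * cfc f Q) := by noncomm_ring
    rw [e1]
    calc _ ≤ ‖(cfc f P * P) * cfc f Q‖ + ‖cfc f P * (Q * cfc f Q)‖ := norm_sub_le _ _
      _ ≤ ‖cfc f P * P‖ * ‖cfc f Q‖ + ‖cfc f P‖ * ‖Q * cfc f Q‖ :=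
        add_le_add (norm_mul_le _ _) (norm_mul_le _ _)
      _ ≤ c * 1 + 1 * c := by
        gcongr
        · exact (key P hP hPM).1
        · exact (key Q hQ hQM).2
      _ = 2 * c := by ring
  have h2 := singularValueFun_add_le (P - Q - cfc f P * (P - Q) * cfc f Q)
    (cfc f P * (P - Q) * cfc f Q) hf.nonneg le_rfl
  rw [sub_add_cancel, add_zero] at h2
  have h3 := singularValueFun_le_norm (cfc f P * (P - Q) * cfc f Q) le_rfl
  linarith [hf.approx]

/-- If Kx ≤ 1, contractivity of every factor suffices. If 2^i ≤ Kx < 2^{i+1}, the factor of scale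
K/2^i is at most 1/2, and its exponent i + 1 exactly beats x < 2^{i+1}/K. The condition on m ensures
that this scale occurs in the product. -/
theorem abs_prod_cayley_mul_le {K M : ℝ} (hK : 0 < K) {m : ℕ} (hm : M * K < 2 ^ m) {x : ℝ}
    (hx : 0 ≤ x) (hxM : x ≤ M) :
    |∏ j ∈ Finset.range m, ((1 - K / 2 ^ j * x) * (1 + K / 2 ^ j * x)⁻¹) ^ (j + 1)| * x ≤
      1 / K := by
  have hb : ∀ j : ℕ, |(1 - K / 2 ^ j * x) * (1 + K / 2 ^ j * x)⁻¹| ≤ 1 := by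
    intro j
    have h1 : 0 ≤ K / 2 ^ j * x := by positivity
    have h2 : 0 < 1 + K / 2 ^ j * x := by positivity
    rw [← div_eq_mul_inv, abs_div, abs_of_pos h2, div_le_one h2, abs_le]
    constructor <;> linarith
  have hb' : ∀ j : ℕ, |((1 - K / 2 ^ j * x) * (1 + K / 2 ^ j * x)⁻¹) ^ (j + 1)| ≤ 1 := by
    intro j
    rw [abs_pow]
    exact pow_le_one₀ (abs_nonneg _) (hb j)
  rw [Finset.abs_prod]
  rcases le_or_gt (K * x) 1 with h | h
  · calc _ ≤ 1 * x :=
          mul_le_mul_of_nonneg_right (Finset.prod_le_one (fun _ _ => abs_nonneg _)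
            fun j _ => hb' j) hx
      _ ≤ 1 / K := by rwa [one_mul, le_div_iff₀' hK]
  · obtain ⟨i, hi1, hi2⟩ := exists_nat_pow_near h.le (one_lt_two : (1 : ℝ) < 2)
    have him : i < m := by
      refine (pow_lt_pow_iff_right₀ (one_lt_two : (1 : ℝ) < 2)).1 (hi1.trans_lt ?_)
      exact lt_of_le_of_lt (by nlinarith) hm
    have hi : |((1 - K / 2 ^ i * x) * (1 + K / 2 ^ i * x)⁻¹) ^ (i + 1)| ≤ (1 / 2) ^ (i + 1) := by
      rw [abs_pow]
      refine pow_le_pow_left₀ (abs_nonneg _) ?_ _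
      have h2i : (0 : ℝ) < 2 ^ i := by positivity
      have h1 : 1 ≤ K / 2 ^ i * x := by
        rw [div_mul_eq_mul_div, le_div_iff₀ h2i]; linarith
      have h2 : K / 2 ^ i * x < 2 := by
        rw [div_mul_eq_mul_div, div_lt_iff₀ h2i]; rw [pow_succ] at hi2; linarith
      have h3 : 0 < 1 + K / 2 ^ i * x := by linarith
      rw [← div_eq_mul_inv, abs_div, abs_of_pos h3, div_le_iff₀ h3, abs_le]
      constructor <;> linarith
    have hprod : ∏ j ∈ Finset.range m,
        |((1 - K / 2 ^ j * x) * (1 + K / 2 ^ j * x)⁻¹) ^ (j + 1)| ≤ (1 / 2) ^ (i + 1) := by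
      rw [← Finset.mul_prod_erase _ _ (Finset.mem_range.2 him)]
      calc _ ≤ (1 / 2 : ℝ) ^ (i + 1) * 1 :=
            mul_le_mul hi (Finset.prod_le_one (fun _ _ => abs_nonneg _) fun j _ => hb' j)
              (Finset.prod_nonneg fun _ _ => abs_nonneg _) (by positivity)
        _ = _ := mul_one _
    calc _ ≤ (1 / 2) ^ (i + 1) * (2 ^ (i + 1) / K) := by
          refine mul_le_mul hprod ?_ hx (by positivity)
          rw [le_div_iff₀' hK]
          exact hi2.le
      _ = 1 / K := by
          rw [← mul_div_assoc, ← mul_pow]; norm_num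

/-- If `P² - Q²` has singular values `o(t^{-2/p})` for positive `P` and `Q`, then `P - Q` has
singular values `o(t^{-1/p})`. -/
theorem singularValuesLittleO_sub_of_sq_sub_sq {p : ℝ} (hp : 0 < p) {P Q : H →L[ℂ] H}
    (hP : 0 ≤ P) (hQ : 0 ≤ Q) (hD : SingularValuesLittleO (p / 2) (P * P - Q * Q)) :
    SingularValuesLittleO p (P - Q) := by
  obtain ⟨C, hC⟩ := hD.bigO (half_pos hp)
  set D := P * P - Q * Q with hDdef
  have hPQ : P * (P - Q) + (P - Q) * Q = D := by rw [hDdef]; noncomm_ring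
  set g : ℝ → ℝ := fun t => t ^ (1 / (p / 2)) * singularValueFun D t with hg
  have hg0 : ∀ t, 0 ≤ t → 0 ≤ g t := fun t ht =>
    mul_nonneg (Real.rpow_nonneg ht _) (singularValueFun_nonneg _ _)
  -- The ranks Nρ^j must be summable against j + 1, yet decay slowly enough that the step sizes
  -- 2^{-j} beat the growth of μ(Nρ^j, D). With ρ = σ^{p/2} that growth is σ^{-j}, and σ² = 1/2
  -- leaves the ratio σ in the error series.
  set σ : ℝ := (√2)⁻¹ with hσ
  have hσ0 : 0 < σ := by positivity
  have hσ1 : σ < 1 := inv_lt_one_of_one_lt₀ (by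
    rw [Real.lt_sqrt zero_le_one]; norm_num)
  have hσ2 : σ * σ = 1 / 2 := by
    rw [hσ, ← mul_inv, Real.mul_self_sqrt two_pos.le, one_div]
  set ρ : ℝ := σ ^ (p / 2) with hρ
  have hρ0 : 0 < ρ := Real.rpow_pos_of_pos hσ0 _
  have hρ1 : ρ < 1 := Real.rpow_lt_one hσ0.le hσ1 (half_pos hp)
  have hsum : ∀ r : ℝ, 0 < r → r < 1 → Summable fun j : ℕ => ((j : ℝ) + 1) * r ^ j := by
    intro r h0 h1
    have h2 : ‖r‖ < 1 := by rwa [Real.norm_of_nonneg h0.le]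
    have := (summable_pow_mul_geometric_of_norm_lt_one 1 h2).add
      (summable_geometric_of_norm_lt_one h2)
    refine this.congr fun j => ?_
    ring
  set C₁ : ℝ := ∑' j : ℕ, ((j : ℝ) + 1) * ρ ^ j with hC₁
  have hC₁0 : 0 < C₁ := (hsum ρ hρ0 hρ1).tsum_pos (fun j => by positivity) 0 (by simp)
  set G : ℝ → ℝ := fun t => ∑' j : ℕ, ((j : ℝ) + 1) * σ ^ j * g (t * ρ ^ j) with hGdef
  have hbound : ∀ t : ℝ, 0 ≤ t → ∀ j : ℕ,
      ‖((j : ℝ) + 1) * σ ^ j * g (t * ρ ^ j)‖ ≤ ((j : ℝ) + 1) * σ ^ j * C := by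
    intro t ht j
    have h1 : 0 ≤ t * ρ ^ j := by positivity
    rw [Real.norm_of_nonneg (mul_nonneg (by positivity) (hg0 _ h1))]
    exact mul_le_mul_of_nonneg_left (hC _ h1) (by positivity)
  have hsC : Summable fun j : ℕ => ((j : ℝ) + 1) * σ ^ j * C := (hsum σ hσ0 hσ1).mul_right C
  -- Each g(tρ^j) tends to 0 and is bounded by C, so dominated convergence applies.
  have hG : Tendsto G atTop (𝓝 0) := by
    have := tendsto_tsum_of_dominated_convergence (𝓕 := atTop)
      (f := fun (t : ℝ) (j : ℕ) => ((j : ℝ) + 1) * σ ^ j * g (t * ρ ^ j))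
      (g := fun _ => 0) hsC
      (fun j => by
        have h1 : Tendsto (fun t : ℝ => g (t * ρ ^ j)) atTop (𝓝 0) :=
          Tendsto.comp hD (tendsto_id.atTop_mul_const (by positivity))
        simpa using h1.const_mul (((j : ℝ) + 1) * σ ^ j))
      (by
        filter_upwards [eventually_ge_atTop 0] with t ht j
        exact hbound t ht j)
    simpa using this
  -- The parameter a balances the iteration error 2aG(N) against the remainder 2/a. It stays fixed
  -- while N tends to infinity.
  have main : ∀ a : ℝ, 0 < a → ∀ N : ℝ, 0 < N →
      N ^ (1 / p) * singularValueFun (P - Q) (C₁ * N) ≤ 2 * a * G N + 2 / a := by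
    intro a ha N hN
    set n : ℝ := N ^ (1 / p) with hn
    have hn0 : 0 < n := Real.rpow_pos_of_pos hN _
    set K : ℝ := a * n with hK
    have hK0 : 0 < K := by positivity
    set M : ℝ := max ‖P‖ ‖Q‖
    obtain ⟨m, hm⟩ := pow_unbounded_of_one_lt (M * K) (one_lt_two : (1 : ℝ) < 2)
    -- Scale K/2^j is used j + 1 times, with rank budget Nρ^j each time.
    have happ := TwoSidedApprox.prod hP hQ (fun j : ℕ =>
      (TwoSidedApprox.cayley hP hQ hPQ (h := K / 2 ^ j) (t := N * ρ ^ j)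
        (by positivity) (by positivity)).pow hP hQ (j + 1)) m
    have h1 := happ.singularValueFun_le hP hQ (c := 1 / K) (M := M) (by positivity)
      (le_max_left _ _) (le_max_right _ _) fun x hx hxM => abs_prod_cayley_mul_le hK0 hm hx hxM
    have hrank : ∑ j ∈ Finset.range m, ((j + 1 : ℕ) : ℝ) * (N * ρ ^ j) ≤ C₁ * N := by
      have h2 := (hsum ρ hρ0 hρ1).sum_le_tsum (Finset.range m) fun j _ => by positivity
      calc _ = (∑ j ∈ Finset.range m, ((j : ℝ) + 1) * ρ ^ j) * N := by
            rw [Finset.sum_mul]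
            refine Finset.sum_congr rfl fun j _ => ?_
            push_cast; ring
        _ ≤ C₁ * N := mul_le_mul_of_nonneg_right h2 hN.le
    have herr : ∑ j ∈ Finset.range m,
        ((j + 1 : ℕ) : ℝ) * (2 * (K / 2 ^ j) * singularValueFun D (N * ρ ^ j)) ≤
          2 * a * G N / n := by
      have hs : Summable fun j : ℕ => ((j : ℝ) + 1) * σ ^ j * g (N * ρ ^ j) :=
        Summable.of_norm_bounded hsC (hbound N hN.le)
      have h2 := hs.sum_le_tsum (Finset.range m) fun j _ =>
        mul_nonneg (by positivity) (hg0 _ (by positivity))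
      calc _ = 2 * a / n * ∑ j ∈ Finset.range m, ((j : ℝ) + 1) * σ ^ j * g (N * ρ ^ j) := by
            rw [Finset.mul_sum]
            refine Finset.sum_congr rfl fun j _ => ?_
            -- Since n = N^{1/p}, this converts μ(Nρ^j, D) into g(Nρ^j)/(n²σ^j).
            have e1 : (N * ρ ^ j) ^ (1 / (p / 2)) = n * n * σ ^ j := by
              rw [Real.mul_rpow hN.le (by positivity), hn, ← Real.rpow_add hN, hρ,
                ← Real.rpow_natCast (σ ^ (p / 2)) j, ← Real.rpow_mul hσ0.le,
                ← Real.rpow_mul hσ0.le, ← Real.rpow_natCast σ j]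
              congr 2 <;> field_simp
              norm_num
            have e2 : (2 : ℝ) ^ j * (σ ^ j * σ ^ j) = 1 := by
              rw [← mul_pow, ← mul_pow, hσ2]; norm_num
            rw [hg]
            simp only
            rw [e1, hK]
            have e3 : 1 / (2 : ℝ) ^ j = σ ^ j * σ ^ j := by
              rw [div_eq_iff (by positivity), ← e2]; ring
            rw [div_eq_mul_one_div (a * n), e3]
            push_cast
            field_simp
        _ ≤ 2 * a / n * G N := mul_le_mul_of_nonneg_left h2 (by positivity)
        _ = _ := by ring
    have h3 := (singularValueFun_anti (P - Q) happ.nonneg hrank).trans h1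
    calc n * singularValueFun (P - Q) (C₁ * N)
        ≤ n * (2 * a * G N / n + 2 * (1 / K)) := by
          refine mul_le_mul_of_nonneg_left (h3.trans ?_) hn0.le
          linarith
      _ = 2 * a * G N + 2 / a := by rw [hK]; field_simp
  have hlim : Tendsto (fun N : ℝ => N ^ (1 / p) * singularValueFun (P - Q) (C₁ * N))
      atTop (𝓝 0) := by
    refine tendsto_zero_of_eventually_le
      (fun _ ht => mul_nonneg (Real.rpow_nonneg ht _) (singularValueFun_nonneg _ _)) ?_
    intro ε hε
    have hGε := (hG.const_mul (2 * (4 / ε))).eventually_le_const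
      (u := ε / 2) (by rw [mul_zero]; positivity)
    -- The choice a = 4/ε makes the remainder 2/a equal to ε/2.
    filter_upwards [hGε, eventually_gt_atTop 0] with N h1 hN
    refine (main (4 / ε) (by positivity) N hN).trans ?_
    have : 2 / (4 / ε) = ε / 2 := by field_simp; norm_num
    linarith
  -- Substitution N = t/C₁ undoes the factor C₁ in the rank.
  have hlim' := (hlim.comp (tendsto_id.atTop_div_const hC₁0)).const_mul (C₁ ^ (1 / p))
  rw [mul_zero] at hlim'
  refine hlim'.congr' ?_
  filter_upwards [eventually_ge_atTop 0] with t ht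
  simp only [Function.comp_apply, id]
  rw [← mul_assoc, ← Real.mul_rpow hC₁0.le (by positivity), mul_div_cancel₀ t hC₁0.ne']

end SquareRoot

/-! ### Graphs of algebraic combinations of partially defined operators -/

namespace LinearPMap

section Graph

variable {H : Type*} [NormedAddCommGroup H] [InnerProductSpace ℂ H]

theorem mem_graph_add {T U : H →ₗ.[ℂ] H} {x y z : H} (hT : (x, y) ∈ T.graph)
    (hU : (x, z) ∈ U.graph) : (x, y + z) ∈ (T + U).graph := by
  obtain ⟨⟨u, hu⟩, h1, h2⟩ := (LinearPMap.mem_graph_iff T).1 hT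
  obtain ⟨⟨v, hv⟩, h3, h4⟩ := (LinearPMap.mem_graph_iff U).1 hU
  dsimp only at h1 h2 h3 h4
  subst h1 h2 h3 h4
  exact (LinearPMap.mem_graph_iff _).2 ⟨⟨v, hu, hv⟩, rfl, rfl⟩

theorem mem_graph_sub {T U : H →ₗ.[ℂ] H} {x y z : H} (hT : (x, y) ∈ T.graph)
    (hU : (x, z) ∈ U.graph) : (x, y - z) ∈ (T - U).graph := by
  obtain ⟨⟨u, hu⟩, h1, h2⟩ := (LinearPMap.mem_graph_iff T).1 hT
  obtain ⟨⟨v, hv⟩, h3, h4⟩ := (LinearPMap.mem_graph_iff U).1 hU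
  dsimp only at h1 h2 h3 h4
  subst h1 h2 h3 h4
  exact (LinearPMap.mem_graph_iff _).2 ⟨⟨v, hu, hv⟩, rfl, rfl⟩

theorem mem_graph_smul {T : H →ₗ.[ℂ] H} {x y : H} (c : ℂ) (hT : (x, y) ∈ T.graph) :
    (x, c • y) ∈ (c • T).graph := by
  obtain ⟨⟨u, hu⟩, h1, h2⟩ := (LinearPMap.mem_graph_iff T).1 hT
  dsimp only at h1 h2
  subst h1 h2
  exact (LinearPMap.mem_graph_iff _).2 ⟨⟨u, hu⟩, rfl, rfl⟩

theorem mem_graph_mulBounded {T : H →ₗ.[ℂ] H} {S : H →L[ℂ] H} {x y : H} :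
    (x, y) ∈ (T.mulBounded S).graph ↔ (S x, y) ∈ T.graph := by
  constructor
  · intro h
    obtain ⟨⟨u, hu⟩, h1, h2⟩ := (LinearPMap.mem_graph_iff _).1 h
    dsimp only at h1 h2
    subst h1 h2
    exact (LinearPMap.mem_graph_iff _).2 ⟨⟨S u, hu⟩, rfl, rfl⟩
  · intro h
    obtain ⟨⟨u, hu⟩, h1, h2⟩ := (LinearPMap.mem_graph_iff _).1 h
    dsimp only at h1 h2
    subst h1 h2
    exact (LinearPMap.mem_graph_iff _).2 ⟨⟨x, hu⟩, rfl, rfl⟩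

theorem mem_graph_boundedMul {T : H →ₗ.[ℂ] H} (S : H →L[ℂ] H) {x y : H}
    (h : (x, y) ∈ T.graph) : (x, S y) ∈ (boundedMul S T).graph := by
  obtain ⟨⟨u, hu⟩, h1, h2⟩ := (LinearPMap.mem_graph_iff T).1 h
  dsimp only at h1 h2
  subst h1 h2
  exact (LinearPMap.mem_graph_iff _).2 ⟨⟨u, hu⟩, rfl, rfl⟩

theorem mem_graph_commutator {T : H →ₗ.[ℂ] H} (S : H →L[ℂ] H) {x y z : H}
    (h : (x, y) ∈ T.graph) (h' : (S x, z) ∈ T.graph) :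
    (x, S y - z) ∈ (commutator S T).graph :=
  mem_graph_sub (mem_graph_boundedMul S h) (mem_graph_mulBounded.2 h')

theorem mem_graph_toPartial {S : H →L[ℂ] H} {x y : H} :
    (x, y) ∈ S.toPartial.graph ↔ S x = y := by
  simp [LinearPMap.mem_graph_iff, ContinuousLinearMap.toPartial]

theorem eq_of_le_toPartial {T : H →ₗ.[ℂ] H} {S : H →L[ℂ] H} (h : T ≤ S.toPartial) {x y : H}
    (hxy : (x, y) ∈ T.graph) : S x = y :=
  mem_graph_toPartial.1 (LinearPMap.le_graph_of_le h hxy)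

theorem eq_toPartial {T : H →ₗ.[ℂ] H} {S : H →L[ℂ] H} (h : ∀ x, (x, S x) ∈ T.graph) :
    T = S.toPartial := by
  refine LinearPMap.eq_of_eq_graph (le_antisymm ?_ ?_)
  · rintro ⟨x, y⟩ hxy
    exact mem_graph_toPartial.2 (LinearPMap.mem_graph_snd_inj T (h x) hxy rfl)
  · rintro ⟨x, y⟩ hxy
    rw [mem_graph_toPartial] at hxy
    subst hxy
    exact h x

theorem memIdeal_of_mem_graph {T : H →ₗ.[ℂ] H} {S : H →L[ℂ] H} (h : ∀ x, (x, S x) ∈ T.graph)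
    {I : Set (H →L[ℂ] H)} (hS : S ∈ I) : T.MemIdeal I := by
  rw [eq_toPartial h]
  exact ⟨dense_univ, S, hS, le_rfl⟩

/-- A densely defined operator `T b` with `T` closed and with a bounded extension is everywhere
defined. -/
theorem mem_graph_of_mulBounded_le {T : H →ₗ.[ℂ] H} (hT : T.IsClosed) {b K : H →L[ℂ] H}
    (hd : Dense ((T.mulBounded b).domain : Set H)) (hK : T.mulBounded b ≤ K.toPartial) (x : H) :
    (b x, K x) ∈ T.graph := by
  have hcl : _root_.IsClosed {x : H | (b x, K x) ∈ T.graph} :=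
    _root_.IsClosed.preimage (b.continuous.prodMk K.continuous) hT
  have hsub : ((T.mulBounded b).domain : Set H) ⊆ {x : H | (b x, K x) ∈ T.graph} := by
    intro y hy
    obtain ⟨z, hz⟩ := LinearPMap.mem_domain_iff.1 hy
    have : K y = z := eq_of_le_toPartial hK hz
    subst this
    exact mem_graph_mulBounded.1 hz
  exact hcl.closure_subset_iff.2 hsub (hd.closure_eq ▸ Set.mem_univ x)

end Graph

/-! ### The absolute value of a self-adjoint operator -/

section SelfAdjoint

variable {H : Type*} [NormedAddCommGroup H] [InnerProductSpace ℂ H] [CompleteSpace H]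
  {A : H →ₗ.[ℂ] H}

theorem mem_graph_graphResolvent (hA : A.IsClosed) (x : H) :
    (A.graphResolvent x, A.mulGraphResolvent x) ∈ A.graph :=
  (mem_closedGraph_iff hA _).1 (Submodule.starProjection_apply_mem _ _)

theorem inner_graphResolvent_add (hA : A.IsClosed) (x : H) {u v : H} (h : (u, v) ∈ A.graph) :
    inner ℂ (A.graphResolvent x) u + inner ℂ (A.mulGraphResolvent x) v = inner ℂ x u := by
  have hm : WithLp.toLp 2 (u, v) ∈ A.closedGraph := (mem_closedGraph_iff hA _).2 h
  have := A.inner_graphProj x hm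
  rw [WithLp.prod_inner_apply] at this
  exact this

theorem graphResolvent_nonneg : 0 ≤ A.graphResolvent := by
  rw [ContinuousLinearMap.nonneg_iff_isPositive, ContinuousLinearMap.isPositive_iff_complex]
  intro x
  have hm : A.graphProj x ∈ A.closedGraph := Submodule.starProjection_apply_mem _ _
  have h := congrArg (starRingEnd ℂ) (A.inner_graphProj x hm)
  rw [inner_conj_symm, inner_conj_symm] at h
  change inner ℂ _ _ = inner ℂ (A.graphResolvent x) x at h
  rw [← h, inner_self_eq_norm_sq_to_K]
  norm_cast
  simp

theorem inner_symm_of_isSelfAdjoint (hA : IsSelfAdjoint A) {u v u' v' : H}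
    (h : (u, v) ∈ A.graph) (h' : (u', v') ∈ A.graph) : inner ℂ v u' = inner ℂ u v' := by
  have hf := A.adjoint_isFormalAdjoint hA.dense_domain
  rw [LinearPMap.isSelfAdjoint_def.1 hA] at hf
  obtain ⟨x, h1, h2⟩ := (LinearPMap.mem_graph_iff A).1 h
  obtain ⟨y, h3, h4⟩ := (LinearPMap.mem_graph_iff A).1 h'
  dsimp only at h1 h2 h3 h4
  subst h1 h2 h3 h4
  exact hf x y

/-- The hypothesis says that y lies in the domain of the adjoint with value w, and the adjoint is A
itself. -/
theorem mem_graph_of_isSelfAdjoint (hA : IsSelfAdjoint A) {y w : H}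
    (h : ∀ u v : H, (u, v) ∈ A.graph → inner ℂ w u = inner ℂ y v) : (y, w) ∈ A.graph := by
  have h' : ∀ x : A.domain, inner ℂ w (x : H) = inner ℂ y (A x) := fun x => h _ _ (A.mem_graph x)
  have hmem := A.mem_adjoint_domain_of_exists y ⟨w, h'⟩
  have e := A.adjoint_apply_eq hA.dense_domain ⟨y, hmem⟩ h'
  have : (y, w) ∈ A.adjoint.graph := (LinearPMap.mem_graph_iff _).2 ⟨⟨y, hmem⟩, rfl, e⟩
  rwa [LinearPMap.isSelfAdjoint_def.1 hA] at this

/-- This is A²(1 + A²)⁻¹ = 1 − (1 + A²)⁻¹, read off from the orthogonality relation that defines the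
projection onto the graph. -/
theorem mem_graph_mulGraphResolvent (hA : IsSelfAdjoint A) (x : H) :
    (A.mulGraphResolvent x, x - A.graphResolvent x) ∈ A.graph := by
  refine mem_graph_of_isSelfAdjoint hA fun u v huv => ?_
  rw [inner_sub_left, ← inner_graphResolvent_add hA.isClosed x huv]
  ring

theorem isSelfAdjoint_mulGraphResolvent (hA : IsSelfAdjoint A) :
    IsSelfAdjoint A.mulGraphResolvent := by
  rw [ContinuousLinearMap.isSelfAdjoint_iff_isSymmetric]
  intro x y
  have h1 := inner_symm_of_isSelfAdjoint hA (mem_graph_mulGraphResolvent hA x)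
    (mem_graph_mulGraphResolvent hA y)
  have h2 := inner_symm_of_isSelfAdjoint hA (mem_graph_graphResolvent hA.isClosed x)
    (mem_graph_graphResolvent hA.isClosed y)
  rw [inner_sub_left, inner_sub_right, h2.symm] at h1
  change inner ℂ (A.mulGraphResolvent x) y = inner ℂ x (A.mulGraphResolvent y)
  linear_combination -h1

/-- Uniqueness for (1 + A²)w = z: the difference d of two solutions has A²d = −d, so ‖Ad‖² = −‖d‖²
forces d = 0. -/
theorem graphResolvent_eq_of_mem_graph (hA : IsSelfAdjoint A) {w a z : H} (h1 : (w, a) ∈ A.graph)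
    (h2 : (a, z - w) ∈ A.graph) : A.graphResolvent z = w := by
  have h3 : (w - A.graphResolvent z, a - A.mulGraphResolvent z) ∈ A.graph :=
    A.graph.sub_mem h1 (mem_graph_graphResolvent hA.isClosed z)
  have h4 : (a - A.mulGraphResolvent z, -(w - A.graphResolvent z)) ∈ A.graph := by
    have := A.graph.sub_mem h2 (mem_graph_mulGraphResolvent hA z)
    convert this using 1
    ext <;> simp
  have h5 := inner_symm_of_isSelfAdjoint hA h3 h4
  rw [inner_neg_right, inner_self_eq_norm_sq_to_K, inner_self_eq_norm_sq_to_K] at h5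
  have h6 : ‖a - A.mulGraphResolvent z‖ ^ 2 = -‖w - A.graphResolvent z‖ ^ 2 := by exact_mod_cast h5
  have h7 : ‖w - A.graphResolvent z‖ = 0 := by
    nlinarith [sq_nonneg ‖a - A.mulGraphResolvent z‖, norm_nonneg (w - A.graphResolvent z)]
  exact (sub_eq_zero.1 (norm_eq_zero.1 h7)).symm

theorem commute_mulGraphResolvent_graphResolvent (hA : IsSelfAdjoint A) :
    Commute A.mulGraphResolvent A.graphResolvent := by
  ext x
  refine (graphResolvent_eq_of_mem_graph hA (mem_graph_mulGraphResolvent hA _) ?_).symm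
  exact A.graph.sub_mem (mem_graph_graphResolvent hA.isClosed _)
    (mem_graph_graphResolvent hA.isClosed _)

/-- One sequence serves A and |A| together: S = A(1 + A²)⁻¹ and |S| have equal norms pointwise, so
convergence of S x_n forces |S| x_n to be Cauchy. Identities between A and |A| then follow from
those for bounded operators by passing to the limit. -/
theorem exists_approx_absOp (hA : A.IsClosed) {u v w : H} (hv : (u, v) ∈ A.graph)
    (hw : (u, w) ∈ A.absOp.graph) : ∃ x : ℕ → H,
      Tendsto (fun n => A.graphResolvent (x n)) atTop (𝓝 u) ∧
      Tendsto (fun n => A.mulGraphResolvent (x n)) atTop (𝓝 v) ∧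
      Tendsto (fun n => CFC.abs A.mulGraphResolvent (x n)) atTop (𝓝 w) := by
  obtain ⟨f, hf, hlim⟩ := mem_closure_iff_seq_limit.1 ((mem_graph_iff_mem_closure hA u v).1 hv)
  choose x hx using hf
  obtain rfl : f = fun n => (A.graphResolvent (x n), A.mulGraphResolvent (x n)) :=
    funext fun n => (hx n).symm
  have hR : Tendsto (fun n => A.graphResolvent (x n)) atTop (𝓝 u) :=
    (continuous_fst.tendsto _).comp hlim
  have hS : Tendsto (fun n => A.mulGraphResolvent (x n)) atTop (𝓝 v) :=
    (continuous_snd.tendsto _).comp hlim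
  have hC : CauchySeq fun n => CFC.abs A.mulGraphResolvent (x n) := by
    have := hS.cauchySeq
    rw [Metric.cauchySeq_iff] at this ⊢
    intro ε hε
    obtain ⟨N, hN⟩ := this ε hε
    refine ⟨N, fun m hm n hn => ?_⟩
    have := hN m hm n hn
    rwa [dist_eq_norm, ← ContinuousLinearMap.map_sub, ContinuousLinearMap.norm_cfcAbs_apply,
      ContinuousLinearMap.map_sub, ← dist_eq_norm]
  obtain ⟨w', hw'⟩ := cauchySeq_tendsto_of_complete hC
  have hmem : (u, w') ∈ A.absOp.graph := by
    rw [graph_absOp hA, mem_absGraph_iff]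
    exact mem_closure_of_tendsto (hR.prodMk_nhds hw') (Eventually.of_forall fun n => ⟨x n, rfl⟩)
  obtain rfl : w = w' := LinearPMap.mem_graph_snd_inj _ hw hmem rfl
  exact ⟨x, hR, hS, hw'⟩

theorem inner_abs_apply_left {S : H →L[ℂ] H} (x y : H) :
    inner ℂ (CFC.abs S x) y = inner ℂ x (CFC.abs S y) :=
  (ContinuousLinearMap.isSelfAdjoint_iff_isSymmetric.1
    (CFC.abs_nonneg S).isSelfAdjoint) x y

theorem inner_absOp_absOp (hA : A.IsClosed) {u v w u' v' w' : H} (hv : (u, v) ∈ A.graph)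
    (hw : (u, w) ∈ A.absOp.graph) (hv' : (u', v') ∈ A.graph) (hw' : (u', w') ∈ A.absOp.graph) :
    inner ℂ w w' = inner ℂ v v' := by
  obtain ⟨x, -, h2, h3⟩ := exists_approx_absOp hA hv hw
  obtain ⟨y, -, h5, h6⟩ := exists_approx_absOp hA hv' hw'
  refine tendsto_nhds_unique (h3.inner h6) ((h2.inner h5).congr fun n => ?_)
  rw [← inner_abs_apply_left, ← ContinuousLinearMap.adjoint_inner_left]
  have h := CFC.abs_mul_abs A.mulGraphResolvent
  exact (congrArg (fun V : H →L[ℂ] H => inner ℂ (V (x n)) (y n)) h).symm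

theorem norm_absOp_eq (hA : A.IsClosed) {u v w : H} (hv : (u, v) ∈ A.graph)
    (hw : (u, w) ∈ A.absOp.graph) : ‖w‖ = ‖v‖ := by
  have h := inner_absOp_absOp hA hv hw hv hw
  rw [inner_self_eq_norm_sq_to_K, inner_self_eq_norm_sq_to_K] at h
  have h' : ‖w‖ ^ 2 = ‖v‖ ^ 2 := by exact_mod_cast h
  exact (pow_left_inj₀ (norm_nonneg _) (norm_nonneg _) two_ne_zero).1 h'

/-- The limit form of the fact that |S| commutes with the self-adjoint operator S. -/
theorem inner_absOp_apply (hA : IsSelfAdjoint A) {u v w u' v' w' : H} (hv : (u, v) ∈ A.graph)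
    (hw : (u, w) ∈ A.absOp.graph) (hv' : (u', v') ∈ A.graph) (hw' : (u', w') ∈ A.absOp.graph) :
    inner ℂ w v' = inner ℂ v w' := by
  obtain ⟨x, -, h2, h3⟩ := exists_approx_absOp hA.isClosed hv hw
  obtain ⟨y, -, h5, h6⟩ := exists_approx_absOp hA.isClosed hv' hw'
  refine tendsto_nhds_unique (h3.inner h5) ((h2.inner h6).congr fun n => ?_)
  have hS := isSelfAdjoint_mulGraphResolvent hA
  have hc := CFC.commute_abs_self A.mulGraphResolvent hS.isStarNormal
  have hs := ContinuousLinearMap.isSelfAdjoint_iff_isSymmetric.1 hS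
  rw [← inner_abs_apply_left]
  refine Eq.trans ?_ (hs (CFC.abs A.mulGraphResolvent (x n)) (y n))
  exact congrArg (fun V : H →L[ℂ] H => inner ℂ (V (x n)) (y n)) hc.eq

/-- The resolvent R commutes with S, hence with |S|. So R|S| is a product of commuting positive
operators, and its positivity and symmetry pass to the limit. -/
theorem absOp_symm_and_nonneg (hA : IsSelfAdjoint A) {u v w : H} (hv : (u, v) ∈ A.graph)
    (hw : (u, w) ∈ A.absOp.graph) :
    (((inner ℂ w u).re : ℂ) = inner ℂ w u ∧ 0 ≤ (inner ℂ w u).re) ∧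
    ∀ {u' v' w' : H}, (u', v') ∈ A.graph → (u', w') ∈ A.absOp.graph →
      inner ℂ w u' = inner ℂ u w' := by
  obtain ⟨x, h1, h2, h3⟩ := exists_approx_absOp hA.isClosed hv hw
  have hS := isSelfAdjoint_mulGraphResolvent hA
  have hR : 0 ≤ A.graphResolvent := graphResolvent_nonneg
  have hRs := ContinuousLinearMap.isSelfAdjoint_iff_isSymmetric.1 (IsSelfAdjoint.of_nonneg hR)
  have hcRS := commute_mulGraphResolvent_graphResolvent hA
  have hc : Commute (CFC.abs A.mulGraphResolvent) A.graphResolvent :=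
    hcRS.cfcAbs_left (by rwa [(IsSelfAdjoint.of_nonneg hR).star_eq])
  have hpos : 0 ≤ A.graphResolvent * CFC.abs A.mulGraphResolvent :=
    hc.symm.mul_nonneg hR (CFC.abs_nonneg _)
  refine ⟨?_, fun {u' v' w'} hv' hw' => ?_⟩
  · rw [ContinuousLinearMap.nonneg_iff_isPositive,
      ContinuousLinearMap.isPositive_iff_complex] at hpos
    have e : ∀ n, inner ℂ ((A.graphResolvent * CFC.abs A.mulGraphResolvent) (x n)) (x n) =
        inner ℂ (CFC.abs A.mulGraphResolvent (x n)) (A.graphResolvent (x n)) := fun n =>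
      hRs (CFC.abs A.mulGraphResolvent (x n)) (x n)
    have hl := h3.inner (𝕜 := ℂ) h1
    have hlre := (Complex.continuous_re.tendsto _).comp hl
    refine ⟨tendsto_nhds_unique ((Complex.continuous_ofReal.tendsto _).comp hlre)
      (hl.congr fun n => ?_), ge_of_tendsto' hlre fun n => ?_⟩
    · have := (hpos (x n)).1
      rw [e] at this
      exact this.symm
    · have := (hpos (x n)).2
      rw [e] at this
      exact this
  · obtain ⟨y, h4, h5, h6⟩ := exists_approx_absOp hA.isClosed hv' hw'
    refine tendsto_nhds_unique (h3.inner h4) ((h1.inner h6).congr fun n => ?_)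
    rw [← inner_abs_apply_left]
    refine Eq.trans ?_ (hRs (CFC.abs A.mulGraphResolvent (x n)) (y n))
    exact congrArg (fun V : H →L[ℂ] H => inner ℂ (V (x n)) (y n)) hc.eq

/-- If `A b` is bounded and everywhere defined, then so is `|A| b`. -/
theorem exists_bounded_absOp_mul (hA : A.IsClosed) {b K : H →L[ℂ] H}
    (hK : ∀ x, (b x, K x) ∈ A.graph) :
    ∃ V : H →L[ℂ] H, ∀ x, (b x, V x) ∈ A.absOp.graph := by
  have hd : ∀ x, b x ∈ A.absOp.domain := fun x => by
    rw [absOp_domain hA]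
    exact LinearPMap.mem_domain_of_mem_graph (hK x)
  let V : H →ₗ[ℂ] H := A.absOp.toFun ∘ₗ b.toLinearMap.codRestrict A.absOp.domain hd
  have hV : ∀ x, (b x, V x) ∈ A.absOp.graph := fun x => A.absOp.mem_graph ⟨b x, hd x⟩
  refine ⟨V.mkContinuous ‖K‖ fun x => ?_, hV⟩
  rw [norm_absOp_eq hA (hK x) (hV x)]
  exact K.le_opNorm x

theorem mem_graph_posPartOp {u v w : H} (hv : (u, v) ∈ A.graph) (hw : (u, w) ∈ A.absOp.graph) :
    (u, (1 / 2 : ℂ) • (w + v)) ∈ A.posPartOp.graph :=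
  mem_graph_smul _ (mem_graph_add hw hv)

theorem mem_graph_negPartOp {u v w : H} (hv : (u, v) ∈ A.graph) (hw : (u, w) ∈ A.absOp.graph) :
    (u, (1 / 2 : ℂ) • (w - v)) ∈ A.negPartOp.graph :=
  mem_graph_smul _ (mem_graph_sub hw hv)

/-- The ranges of the positive and the negative part are orthogonal. -/
theorem inner_negPart_posPart (hA : IsSelfAdjoint A) {u v w u' v' w' : H}
    (hv : (u, v) ∈ A.graph) (hw : (u, w) ∈ A.absOp.graph) (hv' : (u', v') ∈ A.graph)
    (hw' : (u', w') ∈ A.absOp.graph) : inner ℂ (w - v) (w' + v') = 0 := by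
  rw [inner_sub_left, inner_add_right, inner_add_right,
    inner_absOp_absOp hA.isClosed hv hw hv' hw', inner_absOp_apply hA hv hw hv' hw']
  ring

end SelfAdjoint

end LinearPMap

/-! ### The product of the compressed parts, and the theorem -/

section MainResult

variable {H : Type*} [NormedAddCommGroup H] [InnerProductSpace ℂ H] [CompleteSpace H]

theorem rpow_half_mul_self {B : H →L[ℂ] H} (hB : 0 ≤ B) :
    B ^ (1 / 2 : ℝ) * B ^ (1 / 2 : ℝ) = B := by
  rw [← CFC.sqrt_eq_rpow, CFC.sqrt_mul_sqrt_self B hB]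

/-- B need not be invertible, so the exponents are added as positive `NNReal` powers. -/
theorem rpow_three_half {B : H →L[ℂ] H} (hB : 0 ≤ B) :
    B ^ (3 / 2 : ℝ) = B ^ (1 / 2 : ℝ) * B := by
  have h1 : B ^ (3 / 2 : ℝ) = B ^ (3 / 2 : NNReal) := by
    rw [CFC.nnrpow_eq_rpow (by positivity)]; norm_num
  have h2 : B ^ (1 / 2 : ℝ) = B ^ (1 / 2 : NNReal) := by
    rw [CFC.nnrpow_eq_rpow (by positivity)]; norm_num
  have h3 : (3 / 2 : NNReal) = 1 / 2 + 1 := by norm_num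
  rw [h1, h2, h3, CFC.nnrpow_add (by positivity) one_pos, CFC.nnrpow_one B hB]

/-- If `A b` is bounded, `b ≥ 0`, and both `[b, A₊] b²` and `[b³, A₊]` are small, then
`(b A₊ b) (b A₋ b)` is small. -/
theorem singularValuesLittleO_posPart_mul_negPart {p : ℝ} (hp : 0 < p) {A : H →ₗ.[ℂ] H}
    (hA : IsSelfAdjoint A) {b K V G₁ G₂ : H →L[ℂ] H} (hb : IsSelfAdjoint b)
    (hK : ∀ x, (b x, K x) ∈ A.graph) (hV : ∀ x, (b x, V x) ∈ A.absOp.graph)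
    (hKp : SingularValuesBigO (2 * p) K)
    (hG₁ : SingularValuesLittleO (2 * p / 3) G₁) (hG₂ : SingularValuesLittleO (2 * p / 3) G₂)
    (h₁ : (LinearPMap.commutator b A.posPartOp).mulBounded (b * b) ≤ G₁.toPartial)
    (h₂ : LinearPMap.commutator (b * (b * b)) A.posPartOp ≤ G₂.toPartial) :
    SingularValuesLittleO (p / 2)
      (b * ((1 / 2 : ℂ) • (V + K)) * (b * ((1 / 2 : ℂ) • (V - K)))) := by
  set Kp : H →L[ℂ] H := (1 / 2 : ℂ) • (V + K)
  set Km : H →L[ℂ] H := (1 / 2 : ℂ) • (V - K)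
  have hbs := ContinuousLinearMap.isSelfAdjoint_iff_isSymmetric.1 hb
  have hpos : ∀ x, (b x, Kp x) ∈ A.posPartOp.graph := fun x =>
    LinearPMap.mem_graph_posPartOp (hK x) (hV x)
  have e1 : G₁ = b * Kp * b - Kp * (b * b) := by
    ext x
    refine LinearPMap.eq_of_le_toPartial h₁ (LinearPMap.mem_graph_mulBounded.2 ?_)
    exact LinearPMap.mem_graph_commutator b (hpos (b x)) (hpos (b (b x)))
  have e2 : G₂ = (Kp * (b * b)).adjoint - Kp * (b * b) := by
    -- On the domain of A, symmetry of A₊ gives b³A₊x = (A₊b³)*x. Density then carries the identity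
    -- to all of H.
    have hsub : (A.domain : Set H) ⊆ {x | G₂ x = ((Kp * (b * b)).adjoint - Kp * (b * b)) x} := by
      intro x hx
      obtain ⟨v, hv⟩ := LinearPMap.mem_domain_iff.1 hx
      obtain ⟨w, hw⟩ := LinearPMap.mem_domain_iff.1
        ((LinearPMap.absOp_domain hA.isClosed).symm ▸ hx : x ∈ A.absOp.domain)
      have hG := LinearPMap.eq_of_le_toPartial h₂ (LinearPMap.mem_graph_commutator
        (b * (b * b)) (LinearPMap.mem_graph_posPartOp hv hw) (hpos (b (b x))))
      change G₂ x = (Kp * (b * b)).adjoint x - Kp (b (b x))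
      rw [hG]
      congr 1
      apply ext_inner_right ℂ
      intro y
      rw [ContinuousLinearMap.adjoint_inner_left]
      refine (hbs _ _).trans ((hbs _ _).trans ((hbs _ _).trans ?_))
      change inner ℂ ((1 / 2 : ℂ) • (w + v)) (b (b (b y))) =
        inner ℂ x ((1 / 2 : ℂ) • (V (b (b y)) + K (b (b y))))
      rw [inner_smul_left, inner_smul_right, inner_add_left, inner_add_right,
        LinearPMap.inner_symm_of_isSelfAdjoint hA hv (hK _),
        (LinearPMap.absOp_symm_and_nonneg hA hv hw).2 (hK _) (hV _)]
      have h2 : (starRingEnd ℂ) (1 / 2) = 1 / 2 := by simp [Complex.conj_ofNat]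
      rw [h2, add_comm (inner ℂ x _)]
    ext x
    have hcl : IsClosed {x | G₂ x = ((Kp * (b * b)).adjoint - Kp * (b * b)) x} :=
      isClosed_eq (ContinuousLinearMap.continuous _) (ContinuousLinearMap.continuous _)
    exact hcl.closure_subset_iff.2 hsub (hA.dense_domain.closure_eq ▸ Set.mem_univ x)
  -- The bounded form of b³A₊A₋b = 0, from the orthogonality of the ranges of A₊ and A₋.
  have e3 : (Kp * (b * b)).adjoint * Km = 0 := by
    ext x
    apply ext_inner_right ℂ
    intro y
    change inner ℂ ((Kp * (b * b)).adjoint (Km x)) y = inner ℂ (0 : H) y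
    rw [ContinuousLinearMap.adjoint_inner_left, inner_zero_left]
    change inner ℂ ((1 / 2 : ℂ) • (V x - K x)) ((1 / 2 : ℂ) • (V (b (b y)) + K (b (b y)))) = 0
    rw [inner_smul_left, inner_smul_right, LinearPMap.inner_negPart_posPart hA (hK x) (hV x)
      (hK _) (hV _), mul_zero, mul_zero]
  -- In G₁ − G₂ the terms A₊b³ cancel, leaving bA₊b² − (A₊b³)*, and the second term annihilates A₋b.
  have e4 : b * Kp * (b * Km) = (G₁ + (-1 : ℂ) • G₂) * Km := by
    have : (G₁ + (-1 : ℂ) • G₂) = b * Kp * b - (Kp * (b * b)).adjoint := by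
      rw [e1, e2, neg_one_smul]; abel
    rw [this, sub_mul, e3, sub_zero]; noncomm_ring
  have hKm : SingularValuesBigO (2 * p) Km := by
    refine hKp.of_norm_apply_le fun x => ?_
    change ‖(1 / 2 : ℂ) • (V x - K x)‖ ≤ ‖K x‖
    have h := LinearPMap.norm_absOp_eq hA.isClosed (hK x) (hV x)
    calc ‖(1 / 2 : ℂ) • (V x - K x)‖ = 1 / 2 * ‖V x - K x‖ := by rw [norm_smul]; norm_num
      _ ≤ 1 / 2 * (‖V x‖ + ‖K x‖) := by gcongr; exact norm_sub_le _ _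
      _ = ‖K x‖ := by rw [h]; ring
  rw [e4]
  -- The remaining goal is the Hölder relation 3/(2p) + 1/(2p) = 2/p.
  refine (hG₁.add (hG₂.smul (-1))).mul_bigO ?_ hKm
  field_simp
  norm_num

theorem isSelfAdjoint_mul_of_mem_graph {A : H →ₗ.[ℂ] H} (hA : IsSelfAdjoint A)
    {b K : H →L[ℂ] H} (hb : IsSelfAdjoint b) (hK : ∀ x, (b x, K x) ∈ A.graph) :
    IsSelfAdjoint (b * K) := by
  have hbs := ContinuousLinearMap.isSelfAdjoint_iff_isSymmetric.1 hb
  rw [ContinuousLinearMap.isSelfAdjoint_iff_isSymmetric]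
  intro x y
  calc inner ℂ (b (K x)) y = inner ℂ (K x) (b y) := hbs _ _
    _ = inner ℂ (b x) (K y) := LinearPMap.inner_symm_of_isSelfAdjoint hA (hK x) (hK y)
    _ = inner ℂ x (b (K y)) := hbs _ _

theorem nonneg_mul_of_mem_absOp_graph {A : H →ₗ.[ℂ] H} (hA : IsSelfAdjoint A)
    {b K V : H →L[ℂ] H} (hb : IsSelfAdjoint b) (hK : ∀ x, (b x, K x) ∈ A.graph)
    (hV : ∀ x, (b x, V x) ∈ A.absOp.graph) : 0 ≤ b * V := by
  have hbs := ContinuousLinearMap.isSelfAdjoint_iff_isSymmetric.1 hb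
  rw [ContinuousLinearMap.nonneg_iff_isPositive, ContinuousLinearMap.isPositive_iff_complex]
  intro x
  have e : inner ℂ ((b * V) x) x = inner ℂ (V x) (b x) := hbs (V x) x
  rw [e]
  exact (LinearPMap.absOp_symm_and_nonneg hA (hK x) (hV x)).1

/-- With bK = Y − Z and bV = Y + Z, the difference of squares is (Y − Z)² − (Y + Z)² = −2(YZ + ZY),
which the hypothesis and its adjoint control. -/
theorem singularValuesLittleO_abs_sub {p : ℝ} (hp : 0 < p) {A : H →ₗ.[ℂ] H}
    (hA : IsSelfAdjoint A) {b K V : H →L[ℂ] H} (hb : IsSelfAdjoint b)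
    (hK : ∀ x, (b x, K x) ∈ A.graph) (hV : ∀ x, (b x, V x) ∈ A.absOp.graph)
    (h : SingularValuesLittleO (p / 2)
      (b * ((1 / 2 : ℂ) • (V + K)) * (b * ((1 / 2 : ℂ) • (V - K))))) :
    SingularValuesLittleO p (CFC.abs (b * K) - b * V) := by
  have hX := isSelfAdjoint_mul_of_mem_graph hA hb hK
  have hW := nonneg_mul_of_mem_absOp_graph hA hb hK hV
  refine singularValuesLittleO_sub_of_sq_sub_sq hp (CFC.abs_nonneg _) hW ?_
  set Y := b * ((1 / 2 : ℂ) • (V + K)) with hY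
  set Z := b * ((1 / 2 : ℂ) • (V - K)) with hZ
  have hWs := IsSelfAdjoint.of_nonneg hW
  have hYe : Y = (1 / 2 : ℂ) • (b * V + b * K) := by rw [hY, mul_smul_comm, mul_add]
  have hZe : Z = (1 / 2 : ℂ) • (b * V - b * K) := by rw [hZ, mul_smul_comm, mul_sub]
  have hYZ : (Y * Z).adjoint = Z * Y := by
    have h2 : star (1 / 2 : ℂ) = 1 / 2 := by simp
    have hYs : star Y = Y := by rw [hYe, star_smul, star_add, hWs.star_eq, hX.star_eq, h2]
    have hZs : star Z = Z := by rw [hZe, star_smul, star_sub, hWs.star_eq, hX.star_eq, h2]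
    rw [← ContinuousLinearMap.star_eq_adjoint, star_mul, hYs, hZs]
  have e : CFC.abs (b * K) * CFC.abs (b * K) - b * V * (b * V) =
      (-2 : ℂ) • (Y * Z + (Y * Z).adjoint) := by
    have hXe : b * K = Y - Z := by
      rw [hYe, hZe, ← smul_sub, add_sub_sub_cancel, ← two_smul ℂ, smul_smul]; norm_num
    have hWe : b * V = Y + Z := by
      rw [hYe, hZe, ← smul_add, add_add_sub_cancel, ← two_smul ℂ, smul_smul]; norm_num
    rw [CFC.abs_mul_abs, hX.star_eq, hYZ, hWe, hXe, neg_smul, two_smul]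
    noncomm_ring
  rw [e]
  exact (h.add h.adjoint).smul _

end MainResult

theorem theorem5p25 {H : Type*} [NormedAddCommGroup H] [InnerProductSpace ℂ H] [CompleteSpace H]
    (p : ℝ) (hp : 0 < p)
    (B : H →L[ℂ] H) (hB : 0 ≤ B)
    (A : H →ₗ.[ℂ] H) (hA : IsSelfAdjoint A)
    (hi : (A.mulBounded (B ^ (1 / 2 : ℝ))).MemIdeal (weakSchatten H (2 * p)))
    (hii_pos : ((LinearPMap.commutator (B ^ (1 / 2 : ℝ)) A.posPartOp).mulBounded B).MemIdeal
      (weakSchattenZero H (2 * p / 3)))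
    (hii_neg : ((LinearPMap.commutator (B ^ (1 / 2 : ℝ)) A.negPartOp).mulBounded B).MemIdeal
      (weakSchattenZero H (2 * p / 3)))
    (hiii_pos : (LinearPMap.commutator (B ^ (3 / 2 : ℝ)) A.posPartOp).MemIdeal
      (weakSchattenZero H (2 * p / 3)))
    (hiii_neg : (LinearPMap.commutator (B ^ (3 / 2 : ℝ)) A.negPartOp).MemIdeal
      (weakSchattenZero H (2 * p / 3))) :
    ((LinearPMap.boundedMul (B ^ (1 / 2 : ℝ)) (A.mulBounded (B ^ (1 / 2 : ℝ)))).posPartOp -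
        LinearPMap.boundedMul (B ^ (1 / 2 : ℝ)) (A.posPartOp.mulBounded (B ^ (1 / 2 : ℝ)))).MemIdeal
      (weakSchattenZero H p) ∧
    ((LinearPMap.boundedMul (B ^ (1 / 2 : ℝ)) (A.mulBounded (B ^ (1 / 2 : ℝ)))).negPartOp -
        LinearPMap.boundedMul (B ^ (1 / 2 : ℝ)) (A.negPartOp.mulBounded (B ^ (1 / 2 : ℝ)))).MemIdeal
      (weakSchattenZero H p) := by

  set b : H →L[ℂ] H := B ^ (1 / 2 : ℝ) with hbdef
  have hb : IsSelfAdjoint b := IsSelfAdjoint.of_nonneg CFC.rpow_nonneg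
  have hbb : b * b = B := rpow_half_mul_self hB
  obtain ⟨hdense, K, hKmem, hKle⟩ := hi
  have hK := LinearPMap.mem_graph_of_mulBounded_le hA.isClosed hdense hKle
  obtain ⟨V, hV⟩ := LinearPMap.exists_bounded_absOp_mul hA.isClosed hK
  obtain ⟨-, G₁, hG₁, hG₁le⟩ := hii_pos
  obtain ⟨-, G₂, hG₂, hG₂le⟩ := hiii_pos
  rw [← hbb] at hG₁le
  rw [rpow_three_half hB, ← hbdef, ← hbb] at hG₂le
  have hX := isSelfAdjoint_mul_of_mem_graph hA hb hK
  -- In both conclusions the terms ±½bK cancel, so the single operator ½(|bK| − bV) represents both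
  -- differences.
  have hJ := (singularValuesLittleO_abs_sub hp hA hb hK hV
    (singularValuesLittleO_posPart_mul_negPart hp hA hb hK hV
      (singularValuesBigO_of_mem_weakSchatten hKmem)
      (singularValuesLittleO_of_mem_weakSchattenZero hG₁)
      (singularValuesLittleO_of_mem_weakSchattenZero hG₂) hG₁le hG₂le)).smul (1 / 2)
  have hmem := hJ.mem_weakSchattenZero hp
  have hXop : LinearPMap.boundedMul b (A.mulBounded b) = (b * K).toPartial :=
    LinearPMap.eq_toPartial fun x =>
      LinearPMap.mem_graph_boundedMul b (LinearPMap.mem_graph_mulBounded.2 (hK x))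
  have hXg : ∀ x, (x, (b * K) x) ∈ (b * K).toPartial.graph := fun x =>
    LinearPMap.mem_graph_toPartial.2 rfl
  have hXabs : ∀ x, (x, CFC.abs (b * K) x) ∈ (b * K).toPartial.absOp.graph := fun x => by
    rw [LinearPMap.absOp_toPartial _ hX]
    exact LinearPMap.mem_graph_toPartial.2 rfl
  rw [hXop]
  constructor
  · refine LinearPMap.memIdeal_of_mem_graph (fun x => ?_) hmem
    have h := LinearPMap.mem_graph_sub (LinearPMap.mem_graph_posPartOp (hXg x) (hXabs x))
      (LinearPMap.mem_graph_boundedMul b (LinearPMap.mem_graph_mulBounded.2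
        (LinearPMap.mem_graph_posPartOp (hK x) (hV x))))
    convert h using 2
    simp only [ContinuousLinearMap.map_smul, ContinuousLinearMap.map_add, smul_apply, sub_apply,
      mul_apply_eq_comp, ← smul_sub]
    congr 1
    abel
  · refine LinearPMap.memIdeal_of_mem_graph (fun x => ?_) hmem
    have h := LinearPMap.mem_graph_sub (LinearPMap.mem_graph_negPartOp (hXg x) (hXabs x))
      (LinearPMap.mem_graph_boundedMul b (LinearPMap.mem_graph_mulBounded.2
        (LinearPMap.mem_graph_negPartOp (hK x) (hV x))))
    convert h using 2
    simp only [ContinuousLinearMap.map_smul, ContinuousLinearMap.map_sub, smul_apply, sub_apply,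
      mul_apply_eq_comp, ← smul_sub]
    congr 1
    abel
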